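/- **Path-like trees.** Embed a path $P_N$ as a subgraph of the two-dimensional grid and let $L_1,L_2,\dots,L_m$ be its maximal straight segments, in order. If $L_i\cong P_2$ and some $u\in V(L_{i-1})$ is at grid distance $1$ from some $v\in V(L_{i+1})$, an elementary transformation replaces the edge of $L_i$ by the edge $uv$. A tree is *path-like* if it can be obtained from some embedding of a path in the grid by a sequence of elementary transformations. **Linear configurations.** A linear configuration of a tree $T$ is a partition of $V(T)$ into the vertex sets of paths (rows) $P^l=v^l_1v^l_2\cdots v^l_{k_l}$ of $T$, $1\le l\le m$, such that every other edge of $T$ joins two consecutive rows, and $v^l_iv^{l+1}_j\in E(T)$ implies $d_T(v^l_i,v^l_{k_l})=d_T(v^{l+1}_1,v^{l+1}_j)$ and $j>1$. Write $w^+$ (resp. $w^-$) if a vertex $w$ has a neighbour in the next (resp. previous) row. **Trees of type $H$.** For $1<a<s$, $1<b<t$, $r\ge1$, the tree of type $H$ with parameters $(s,t;r;a,b)$ consists of two paths $u_1\cdots u_s$ and $v_1\cdots v_t$ and a path of length $r$ (the vertical path) joining $u=u_a$ to $v=v_b$. A linear configuration of it has vertical path - $\pi$ if $u^-,v^+$ lie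 in the same row, $u$ before $v$; $\gamma$ if $u^-,v^+$ lie in the same row, $v$ before $u$; - $\beta$, $\mu$, $\sigma^+$, $\sigma^-$ if the row of $u$ precedes the row of $v$ and we have respectively $(u^+,v^-)$, $(u^-,v^+)$, $(u^+,v^+)$, $(u^-,v^-)$. We say that the tree of type $H$ with parameters $(s,t;r;a,b)$ *is path-like with vertical path $\alpha$, horizontal divisors $d,d'$ and vertical divisor $\delta$* (all positive integers) if it has a linear configuration with vertical path $\alpha$ and - $\alpha=\pi$: $d=a$, $d'=b$, $a\mid s$, $b\mid t$, $a\le s-a$, $b\le t-b$; by convention $\delta=1$. - $\alpha=\gamma$: $d=b+r$, $d'=a+r$, $d\mid s-a$, $d'\mid t-b$, $d\le s-a$, $d'\le t-b$; by convention $\delta=1$. - $\alpha=\beta$: $d\mid s$, $d'\mid t$, $\delta\mid r-1$ and one of: (1) $2\le\delta\le\min\{d,d'\}-1$, $d-\delta=\min\{a-1,s-a\}$, $d'-\delta=\min\{b-1,t-b\}$; (2) $d=s$, $d'=t$, $\delta\in\{a,s-a+1\}\cap\{b,t-b+1\}$; (3) $d=s$, $d'-\delta=\min\{b-1,t-b\}$,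 $\delta\in\{a,s-a+1\}$; (4) $d-\delta=\min\{a-1,s-a\}$, $d'=t$, $\delta\in\{b,t-b+1\}$. - $\alpha=\mu$: for some $\phi_1\in\{a,s-a+1\}$, $\phi_2\in\{b,t-b+1\}$: $d\mid s-\phi_1$, $d'\mid t-\phi_2$, $\delta=d+\phi_1-1=d'+\phi_2-1$ and $\delta\mid r+1-d-d'\ge0$. - $\alpha=\sigma^-$: for some $\phi_1\in\{a,s-a+1\}$: $d\mid s-\phi_1$, $d'\mid t$, $\delta=d+\phi_1-1$, $\delta\mid r-d\ge0$, $d'-\delta\in\{b-1,t-b\}$. - $\alpha=\sigma^+$: for some $\phi_2\in\{b,t-b+1\}$: $d\mid s$, $d'\mid t-\phi_2$, $\delta=d'+\phi_2-1$, $\delta\mid r-d'\ge0$, $d-\delta\in\{a-1,s-a\}$. **Trees in $\mathcal H_n$.** Let $n\ge2$. A tree in $\mathcal H_n$ with parameters $(H_n;R_{n-1};A_{n-1},B_{n-1})$, where $H_n=(h_1,\dots,h_n)$, $R_{n-1}=(r_1,\dots,r_{n-1})$, $A_{n-1}=(a_1,\dots,a_{n-1})$, $B_{n-1}=(b_1,\dots,b_{n-1})$,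 $r_i\ge1$, $1<a_i<h_i$, $1<b_i<h_{i+1}$, and $b_{i-1}+a_i\le h_i$ for $2\le i\le n-1$, consists of horizontal paths $\overline P^1,\dots,\overline P^n$ of orders $h_1,\dots,h_n$ and, for $1\le i\le n-1$, a vertical path of length $r_i$ from the vertex number $h_i-a_i+1$ of $\overline P^i$ to the vertex number $b_i$ of $\overline P^{i+1}$. (So it cuts off a final part of order $a_i$ of $\overline P^i$ and an initial part of order $b_i$ of $\overline P^{i+1}$, end vertices of the vertical path included.) **Theorem.** Let $T$ be a tree in $\mathcal H_n$ with parameters $(H_n;R_{n-1};A_{n-1},B_{n-1})$ in which no horizontal path contains two adjacent vertices of degree $3$. Suppose that there are $\alpha_i\in\{\pi,\gamma,\beta,\mu,\sigma^+,\sigma^-\}$, positive integers $\delta^i$ $(1\le i\le n-1)$ and $d_i$ $(1\le i\le n)$, and integers $s_i$ $(1\le i\le n-1)$ and $t_i$ $(2\le i\le n)$ with $s_1=h_1$ and $t_n=h_n$, such that: (i), (ii) For every $1\le i\le n-1$, the tree $T_i$ of type $H$ with parameters $(s_i,t_{i+1};r_i;a_i,b_i)$ is path-like with vertical path $\alpha_i$,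 horizontal divisors $d_i,d_{i+1}$ and vertical divisor $\delta^i$. Here $a_1$ may be replaced by $h_1-a_1+1$ in $T_1$, and $b_{n-1}$ by $h_n-b_{n-1}+1$ in $T_{n-1}$ (the position on an outermost horizontal path may be counted from either end). Moreover, for $2\le i\le n-1$, either $t_i=h_i$ and then either $s_i=d_i+a_i$ and $\alpha_i=\pi$, or $s_i=d_i$ and $\alpha_i\in\{\beta,\sigma^+\}$; or $t_i=h_i-a_i$, $s_i=d_i+a_i$ and $\alpha_i\in\{\gamma,\mu,\sigma^-\}$. (iii) For every $2\le i\le n-1$, $$d_i=\begin{cases} b_{i-1}&\text{if }\alpha_{i-1}=\pi\\ a_{i-1}+r_{i-1}&\text{if }\alpha_{i-1}=\gamma,\ i\ne2\\ a_1+r_1\text{ or }h_1-a_1+1+r_1&\text{if }\alpha_1=\gamma,\ i=2\\ \delta^{i-1}+b_{i-1}-1&\text{if }\alpha_{i-1}\in\{\beta,\sigma^-\},\ \delta^{i-1}\ne b_{i-1}\\ h_i&\text{if }\alpha_{i-1}\in\{\beta,\sigma^-\},\ \delta^{i-1}=b_{i-1}\\ \delta^{i-1}-b_{i-1}+1&\text{if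 }\alpha_{i-1}\in\{\mu,\sigma^+\}\end{cases}$$ and $$d_i=\begin{cases} a_i&\text{if }\alpha_i=\pi\\ b_i+r_i&\text{if }\alpha_i=\gamma,\ i\ne n-1\\ b_{n-1}+r_{n-1}\text{ or }h_n-b_{n-1}+1+r_{n-1}&\text{if }\alpha_{n-1}=\gamma,\ i=n-1\\ \delta^i+a_i-1&\text{if }\alpha_i\in\{\beta,\sigma^+\},\ \delta^i\ne a_i\\ h_i&\text{if }\alpha_i\in\{\beta,\sigma^+\},\ \delta^i=a_i\\ \delta^i-a_i+1&\text{if }\alpha_i\in\{\mu,\sigma^-\}.\end{cases}$$ (iv) For every $2\le i\le n-1$ with $\alpha_i\in\{\beta,\sigma^+\}$: if $\alpha_{i-1}\in\{\pi,\gamma,\mu,\sigma^+\}$, or $\alpha_{i-1}\in\{\beta,\sigma^-\}$ and $d_i<h_i$, then $d_i=\delta^i+a_i-1$; if $\alpha_{i-1}\in\{\beta,\sigma^-\}$ and $d_i=h_i$, then either $\delta^{i-1}=b_{i-1}$ and $\delta^i=a_i$, or $\delta^{i-1}=h_i-b_{i-1}+1$ and $\delta^i=h_i-a_i+1$. Then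 $T$ is a path-like tree. -/

import Mathlib

/-! ### Path-like trees -/

/-- Adjacency in the two-dimensional integer grid. -/
def GridAdj (p q : ℤ × ℤ) : Prop := |p.1 - q.1| + |p.2 - q.2| = 1

/-- `f 0, …, f (N - 1)` is an embedding of the path on `N` vertices in the integer grid. -/
def IsGridPath (N : ℕ) (f : ℕ → ℤ × ℤ) : Prop :=
  (∀ i j, i < N → j < N → f i = f j → i = j) ∧ ∀ i, i + 1 < N → GridAdj (f i) (f (i + 1))

/-- The direction of the `i`-th edge of an embedded path. -/
def gridStep (f : ℕ → ℤ × ℤ) (i : ℕ) : ℤ × ℤ := f (i + 1) - f i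

/-- An elementary transformation `G ↦ G'` with respect to the embedded path `f`. The edge from
`f (c + 1)` to `f (c + 2)` is on its own a maximal straight segment `L`; the preceding maximal
straight segment `L⁻` ends at `f (c + 1)`, the following one `L⁺` starts at `f (c + 2)`;
`u ∈ L⁻` and `v ∈ L⁺` are at distance `1` in the grid, and the edge of `L` is replaced by `uv`. -/
def ElementaryTransformation (N : ℕ) (f : ℕ → ℤ × ℤ) (G G' : SimpleGraph (Fin N)) : Prop :=
  ∃ (c : ℕ) (hc : c + 3 < N) (u v : Fin N),
    gridStep f c ≠ gridStep f (c + 1) ∧ gridStep f (c + 2) ≠ gridStep f (c + 1) ∧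
    (u.val ≤ c + 1 ∧ ∀ i, u.val ≤ i → i < c + 1 → gridStep f i = gridStep f c) ∧
    (c + 2 ≤ v.val ∧ ∀ i, c + 2 ≤ i → i < v.val → gridStep f i = gridStep f (c + 2)) ∧
    GridAdj (f u) (f v) ∧
    G.Adj ⟨c + 1, by omega⟩ ⟨c + 2, by omega⟩ ∧
    G' = G.deleteEdges {s(⟨c + 1, by omega⟩, ⟨c + 2, by omega⟩)} ⊔ SimpleGraph.edge u v

/-- `T` is path-like: it is obtained from some embedding of a path in the grid by a (possibly
empty) sequence of elementary transformations. -/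
def IsPathLike {V : Type*} (T : SimpleGraph V) : Prop :=
  ∃ (N : ℕ) (f : ℕ → ℤ × ℤ) (G : SimpleGraph (Fin N)), IsGridPath N f ∧
    Relation.ReflTransGen (ElementaryTransformation N f) (SimpleGraph.pathGraph N) G ∧
    Nonempty (T ≃g G)

/-! ### Linear configurations and vertical paths -/

/-- A linear configuration of a tree `T`: the vertices are arranged in rows `1, …, m`, row `l`
being a path `v^l_1 v^l_2 … v^l_{len l}` of `T`; the other edges join consecutive rows, and an edge
`v^l_i v^{l+1}_j` satisfies `d(v^l_i, v^l_{len l}) = d(v^{l+1}_1, v^{l+1}_j)`, that is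
`len l - i = j - 1`, and `j > 1`. The vertex `x` is `v^l_i` with `l = row x`, `i = idx x`. -/
structure LinearConfig {V : Type*} (T : SimpleGraph V) where
  m : ℕ
  len : ℕ → ℕ
  row : V → ℕ
  idx : V → ℕ
  len_pos : ∀ l, 1 ≤ l → l ≤ m → 1 ≤ len l
  row_mem : ∀ x, 1 ≤ row x ∧ row x ≤ m
  idx_mem : ∀ x, 1 ≤ idx x ∧ idx x ≤ len (row x)
  inj : ∀ x y, row x = row y → idx x = idx y → x = y
  surj : ∀ l j, 1 ≤ l → l ≤ m → 1 ≤ j → j ≤ len l → ∃ x, row x = l ∧ idx x = j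
  adj_row : ∀ x y, row x = row y → (T.Adj x y ↔ idx y = idx x + 1 ∨ idx x = idx y + 1)
  adj_next : ∀ x y, T.Adj x y → row x < row y →
    row y = row x + 1 ∧ len (row x) + 1 = idx x + idx y ∧ 1 < idx y

/-- The six kinds of vertical paths: parallel `π`, crossed `γ`, bridge `β`, indirect `μ`,
semi-indirect `σ⁺` and `σ⁻`. -/
inductive VerticalPath where
  | pi | gamma | beta | mu | sigmaPlus | sigmaMinus

namespace LinearConfig

variable {V : Type*} {T : SimpleGraph V}

/-- `x⁺`: the vertex `x` has a neighbour in the next row. -/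
def Plus (C : LinearConfig T) (x : V) : Prop := ∃ y, T.Adj x y ∧ C.row y = C.row x + 1

/-- `x⁻`: the vertex `x` has a neighbour in the previous row. -/
def Minus (C : LinearConfig T) (x : V) : Prop := ∃ y, T.Adj x y ∧ C.row x = C.row y + 1

/-- In the linear configuration, the path from the branch vertex `u` to the branch vertex `v`
(in the order in which they are met from left to right along `T`) is of the given kind. -/
def HasVerticalPath (C : LinearConfig T) (u v : V) : VerticalPath → Prop
  | .pi => C.row u = C.row v ∧ C.idx u < C.idx v ∧ C.Minus u ∧ C.Plus v
  | .gamma => C.row u = C.row v ∧ C.idx v < C.idx u ∧ C.Minus u ∧ C.Plus v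
  | .beta => C.row u < C.row v ∧ C.Plus u ∧ C.Minus v
  | .mu => C.row u < C.row v ∧ C.Minus u ∧ C.Plus v
  | .sigmaPlus => C.row u < C.row v ∧ C.Plus u ∧ C.Plus v
  | .sigmaMinus => C.row u < C.row v ∧ C.Minus u ∧ C.Minus v

end LinearConfig

/-! ### Horizontal paths joined by vertical paths -/

/-- Names for vertices: `inl (i, j)` is the `j`-th vertex of the `i`-th horizontal path,
`inr (i, j)` the `j`-th interior vertex of the `i`-th vertical path. -/
abbrev GridName : Type := (ℕ × ℕ) ⊕ (ℕ × ℕ)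

/-- The vertices for `n` horizontal paths with `h 1, …, h n` vertices and `n - 1` vertical paths of
lengths `r 1, …, r (n - 1)`. -/
def ladderVerts (n : ℕ) (h r : ℕ → ℕ) : Set GridName :=
  {x | (∃ i j, 1 ≤ i ∧ i ≤ n ∧ 1 ≤ j ∧ j ≤ h i ∧ x = Sum.inl (i, j)) ∨
    (∃ i j, 1 ≤ i ∧ i < n ∧ 1 ≤ j ∧ j < r i ∧ x = Sum.inr (i, j))}

/-- The `j`-th vertex (`0 ≤ j ≤ r i`) of the `i`-th vertical path, which leads from the vertex
`p i` of the `i`-th horizontal path to the vertex `q i` of the `(i + 1)`-st one. -/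
def verticalVertex (r p q : ℕ → ℕ) (i j : ℕ) : GridName :=
  if j = 0 then Sum.inl (i, p i) else if j = r i then Sum.inl (i + 1, q i) else Sum.inr (i, j)

/-- The edges of the horizontal and of the vertical paths. -/
def ladderEdges (n : ℕ) (h r p q : ℕ → ℕ) : Set (Sym2 GridName) :=
  {e | (∃ i j, 1 ≤ i ∧ i ≤ n ∧ 1 ≤ j ∧ j < h i ∧ e = s(Sum.inl (i, j), Sum.inl (i, j + 1))) ∨
    (∃ i j, 1 ≤ i ∧ i < n ∧ j < r i ∧
      e = s(verticalVertex r p q i j, verticalVertex r p q i (j + 1)))}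

/-- Horizontal paths of orders `h 1, …, h n`, the `i`-th and `(i + 1)`-st of which are joined by a
path of length `r i` between their vertices number `p i` and `q i` respectively. -/
def ladderTree (n : ℕ) (h r p q : ℕ → ℕ) : SimpleGraph (ladderVerts n h r) :=
  (SimpleGraph.fromEdgeSet (ladderEdges n h r p q)).induce (ladderVerts n h r)

/-! ### Trees of type `H` -/

/-- The orders `s`, `t` of the two horizontal paths of a tree of type `H`. -/
def pairSize (s t : ℕ) (i : ℕ) : ℕ := if i = 1 then s else t

/-- Admissible parameters `(s, t; r; a, b)` of a tree of type `H`. -/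
def IsTypeHParam (s t r a b : ℕ) : Prop := 1 < a ∧ a < s ∧ 1 < b ∧ b < t ∧ 1 ≤ r

/-- The tree of type `H` with parameters `(s, t; r; a, b)`: paths `u_1 … u_s` and `v_1 … v_t`
together with a path of length `r` from `u_a` to `v_b`. -/
abbrev typeHTree (s t r a b : ℕ) : SimpleGraph (ladderVerts 2 (pairSize s t) (fun _ => r)) :=
  ladderTree 2 (pairSize s t) (fun _ => r) (fun _ => a) (fun _ => b)

/-- `d₁`, `d₂` are horizontal divisors and `δ` is a vertical divisor of the tree of type `H` with
parameters `(s, t; r; a, b)`, for a vertical path of the given kind (`δ = 1` by convention for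
parallel and crossed paths). -/
def AreDivisors (s t r a b d₁ d₂ δ : ℕ) : VerticalPath → Prop
  | .pi => d₁ = a ∧ d₂ = b ∧ a ∣ s ∧ b ∣ t ∧ a ≤ s - a ∧ b ≤ t - b ∧ δ = 1
  | .gamma => d₁ = b + r ∧ d₂ = a + r ∧ (b + r) ∣ (s - a) ∧ (a + r) ∣ (t - b) ∧
      b + r ≤ s - a ∧ a + r ≤ t - b ∧ δ = 1
  | .beta => δ ∣ (r - 1) ∧
      ((d₁ ∣ s ∧ d₂ ∣ t ∧ 2 ≤ δ ∧ δ < min d₁ d₂ ∧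
          d₁ = δ + min (a - 1) (s - a) ∧ d₂ = δ + min (b - 1) (t - b)) ∨
        (d₁ = s ∧ d₂ = t ∧ (δ = a ∨ δ = s - a + 1) ∧ (δ = b ∨ δ = t - b + 1)) ∨
        (d₁ = s ∧ d₂ ∣ t ∧ d₂ = δ + min (b - 1) (t - b) ∧ (δ = a ∨ δ = s - a + 1)) ∨
        (d₁ ∣ s ∧ d₁ = δ + min (a - 1) (s - a) ∧ d₂ = t ∧ (δ = b ∨ δ = t - b + 1)))
  | .mu => ∃ φ₁ φ₂, (φ₁ = a ∨ φ₁ = s - a + 1) ∧ (φ₂ = b ∨ φ₂ = t - b + 1) ∧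
      d₁ ∣ (s - φ₁) ∧ d₂ ∣ (t - φ₂) ∧ δ + 1 = d₁ + φ₁ ∧ δ + 1 = d₂ + φ₂ ∧
      d₁ + d₂ ≤ r + 1 ∧ δ ∣ (r + 1 - (d₁ + d₂))
  | .sigmaMinus => ∃ φ₁, (φ₁ = a ∨ φ₁ = s - a + 1) ∧ d₁ ∣ (s - φ₁) ∧ d₂ ∣ t ∧
      δ + 1 = d₁ + φ₁ ∧ d₁ ≤ r ∧ δ ∣ (r - d₁) ∧ (d₂ = δ + (b - 1) ∨ d₂ = δ + (t - b))
  | .sigmaPlus => ∃ φ₂, (φ₂ = b ∨ φ₂ = t - b + 1) ∧ d₁ ∣ s ∧ d₂ ∣ (t - φ₂) ∧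
      δ + 1 = d₂ + φ₂ ∧ d₂ ≤ r ∧ δ ∣ (r - d₂) ∧ (d₁ = δ + (a - 1) ∨ d₁ = δ + (s - a))

/-- The tree of type `H` with parameters `(s, t; r; a, b)` is a path-like tree with vertical path
`α`, horizontal divisors `d₁`, `d₂` and vertical divisor `δ`: it has a linear configuration in which
its vertical path is of kind `α`, and `d₁`, `d₂`, `δ` are divisors for `α`. -/
def IsPathLikeTypeH (s t r a b : ℕ) (α : VerticalPath) (d₁ d₂ δ : ℕ) : Prop :=
  IsTypeHParam s t r a b ∧
  (∃ (C : LinearConfig (typeHTree s t r a b)) (u v : ladderVerts 2 (pairSize s t) (fun _ => r)),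
    u.val = Sum.inl (1, a) ∧ v.val = Sum.inl (2, b) ∧ C.HasVerticalPath u v α) ∧
  AreDivisors s t r a b d₁ d₂ δ α

/-! ### Trees in `𝓗_n` -/

/-- Admissible parameters `(H_n; R_{n-1}; A_{n-1}, B_{n-1})` of a tree in `𝓗_n`. The last condition
says that the end parts cut off on an inner horizontal path are disjoint, so that its two branch
vertices are distinct. -/
def IsHnParam (n : ℕ) (h r a b : ℕ → ℕ) : Prop :=
  2 ≤ n ∧ (∀ i, 1 ≤ i → i < n → 1 ≤ r i) ∧
  (∀ i, 1 ≤ i → i < n → 1 < a i ∧ a i < h i ∧ 1 < b i ∧ b i < h (i + 1)) ∧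
  (∀ i, 2 ≤ i → i < n → b (i - 1) + a i ≤ h i)

/-- The tree in `𝓗_n` with parameters `(H_n; R_{n-1}; A_{n-1}, B_{n-1})`: the `i`-th vertical path
starts at the vertex of the `i`-th horizontal path that cuts off the final part of order `a i`, and
ends at the vertex of the next one that cuts off the initial part of order `b i`. -/
abbrev hnTree (n : ℕ) (h r a b : ℕ → ℕ) : SimpleGraph (ladderVerts n h r) :=
  ladderTree n h r (fun i => h i - a i + 1) b

/-- `T` is a tree in `𝓗_n` with the given parameters. -/
def IsTreeInHn {V : Type*} (T : SimpleGraph V) (n : ℕ) (h r a b : ℕ → ℕ) : Prop :=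
  IsHnParam n h r a b ∧ Nonempty (T ≃g hnTree n h r a b)

/-- No horizontal path contains two adjacent vertices of degree `3`. -/
def NoAdjacentDegreeThree (n : ℕ) (h r a b : ℕ → ℕ) : Prop :=
  ∀ x y : ladderVerts n h r, ∀ i j k, x.val = Sum.inl (i, j) → y.val = Sum.inl (i, k) →
    ((hnTree n h r a b).neighborSet x).ncard = 3 →
    ((hnTree n h r a b).neighborSet y).ncard = 3 → ¬ (hnTree n h r a b).Adj x y

/-! ### The glue conditions -/

/-- The rules that determine the order `t_i ∈ {h_i, h_i - a_i}` of the second path of `T_{i-1}`,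
the order `s_i ∈ {d_i, d_i + a_i}` of the first path of `T_i`, and the kind `α_i`. -/
def OrderRule (hi ai si ti di : ℕ) (α : VerticalPath) : Prop :=
  (ti = hi ∧ ((si = di + ai ∧ α = .pi) ∨ (si = di ∧ (α = .beta ∨ α = .sigmaPlus)))) ∨
  (ti = hi - ai ∧ si = di + ai ∧ (α = .gamma ∨ α = .mu ∨ α = .sigmaMinus))

/-- The value that the left vertical path `α_{i-1}` prescribes for `d_i`, `2 ≤ i ≤ n - 1`. -/
def GlueLeft (h r a b d δ : ℕ → ℕ) (i : ℕ) : VerticalPath → Prop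
  | .pi => d i = b (i - 1)
  | .gamma => d i = a (i - 1) + r (i - 1) ∨ (i = 2 ∧ d i = h 1 - a 1 + 1 + r 1)
  | .beta | .sigmaMinus => (δ (i - 1) ≠ b (i - 1) → d i + 1 = δ (i - 1) + b (i - 1)) ∧
      (δ (i - 1) = b (i - 1) → d i = h i)
  | .mu | .sigmaPlus => d i + b (i - 1) = δ (i - 1) + 1

/-- The value that the right vertical path `α_i` prescribes for `d_i`, `2 ≤ i ≤ n - 1`. -/
def GlueRight (n : ℕ) (h r a b d δ : ℕ → ℕ) (i : ℕ) : VerticalPath → Prop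
  | .pi => d i = a i
  | .gamma => d i = b i + r i ∨
      (i = n - 1 ∧ d i = h n - b (n - 1) + 1 + r (n - 1))
  | .beta | .sigmaPlus => (δ i ≠ a i → d i + 1 = δ i + a i) ∧ (δ i = a i → d i = h i)
  | .mu | .sigmaMinus => d i + a i = δ i + 1

/-- The additional condition when the right vertical path `α_i` is `β` or `σ⁺`. -/
def GlueExtra (h a b d δ : ℕ → ℕ) (α : ℕ → VerticalPath) (i : ℕ) : Prop :=
  α i = .beta ∨ α i = .sigmaPlus →
    ((α (i - 1) = .pi ∨ α (i - 1) = .gamma ∨ α (i - 1) = .mu ∨ α (i - 1) = .sigmaPlus) ∨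
        ((α (i - 1) = .beta ∨ α (i - 1) = .sigmaMinus) ∧ d i < h i) →
      d i + 1 = δ i + a i) ∧
    ((α (i - 1) = .beta ∨ α (i - 1) = .sigmaMinus) ∧ d i = h i →
      (δ (i - 1) = b (i - 1) ∧ δ i = a i) ∨
        (δ (i - 1) = h i - b (i - 1) + 1 ∧ δ i = h i - a i + 1))

/-! Written one after another, the rows of a linear configuration number the vertices `0, …, N - 1`.
Edges inside a row join consecutive numbers. The edge between two successive rows has both ends
equally far, say `e`, from the break `{k, k + 1}`, so it replaces `{k, k + 1}` by `{k - e, k + 1 +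
e}`. Draw the path in the grid as a boustrophedon turning at the breaks with `e > 0`: the two ends
face each other across the turn, so each replacement is an elementary transformation
(`elementaryTransformation_offset`, `isPathLike_offsetGraph`). Hence it is enough to arrange the
vertices in rows along edges of the tree; having at most `N - 1` edges, the tree has no others
(`eq_offsetGraph`, `Built.isPathLike`).

The rows are constructed along the ladder. What has to be remembered is a `Port`: a vertex `x` at
distance `d - 1` from the end of the last row. The next row must have a neighbour of `x` at index `d
- 1`. A path whose length is a multiple of `d` folds into rows of length `d` and reproduces the port
(`Port.snake`); this is the role of the divisibility conditions. Around a branch vertex one special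
row changes the parameter of the port (`minus_mid`, `mid_minus`, `mid_plus`, `minus_plus_parallel`,
`minus_plus_crossed`).

The glue conditions make the parameter left by one vertical path the one needed by the next.
`exists_divisors` distils them into `Divisors`, `ready_succ` is the induction step and
`exists_built` completes the arrangement. Counting a position on an outermost path from its other
end amounts to reversing that path (`isLadder_reverseIf`). -/

namespace LadderConfig

/-! ### Numberings with offsets -/

/-- Offsets `e k` for the edges `{k, k + 1}` of a path with vertices `0, …, N - 1`: the edge is to be
replaced by `{k - e k, k + 1 + e k}`, and no other replaced edge lies between these vertices. -/
def IsOffset (N : ℕ) (e : ℕ → ℕ) : Prop :=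
  (∀ k, 0 < e k → e k ≤ k ∧ k + 1 + e k < N) ∧
  ∀ k k', 0 < e k → 0 < e k' → k' ≠ k → k' + e k < k ∨ k + e k < k'

/-- The path `0, …, N - 1` with every edge `{k, k + 1}` replaced by `{k - e k, k + 1 + e k}`. -/
def offsetGraph (N : ℕ) (e : ℕ → ℕ) : SimpleGraph (Fin N) where
  Adj x y := ∃ k, (x.val + e k = k ∧ y.val = k + 1 + e k) ∨ (y.val + e k = k ∧ x.val = k + 1 + e k)
  symm := ⟨fun _ _ ⟨k, hk⟩ => ⟨k, hk.symm⟩⟩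
  loopless := ⟨fun x ⟨k, hk⟩ => by omega⟩

theorem offsetGraph_zero (N : ℕ) : offsetGraph N (fun _ => 0) = SimpleGraph.pathGraph N := by
  ext x y
  rw [SimpleGraph.pathGraph_adj]
  constructor
  · rintro ⟨k, hk⟩
    simp only [add_zero] at hk
    omega
  · rintro (h | h)
    · exact ⟨x, Or.inl ⟨rfl, h.symm⟩⟩
    · exact ⟨y, Or.inr ⟨rfl, h.symm⟩⟩

/-! ### The boustrophedon embedding -/

/-- The number of positive offsets before `k`. -/
def turns (e : ℕ → ℕ) : ℕ → ℕ
  | 0 => 0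
  | k + 1 => if e k = 0 then turns e k else turns e k + 1

/-- The abscissa of the `k`-th vertex of the boustrophedon that turns at the positive offsets. -/
def abscissa (e : ℕ → ℕ) : ℕ → ℤ
  | 0 => 0
  | k + 1 => if e k = 0 then abscissa e k + (-1) ^ turns e k else abscissa e k

/-- The boustrophedon that turns at the positive offsets. -/
def zigzag (e : ℕ → ℕ) (k : ℕ) : ℤ × ℤ := (abscissa e k, turns e k)

theorem turns_mono (e : ℕ → ℕ) : Monotone (turns e) :=
  monotone_nat_of_le_succ fun k => by simp only [turns]; split_ifs <;> omega

theorem straight {e : ℕ → ℕ} {i m : ℕ} (he : ∀ k, i ≤ k → k < i + m → e k = 0) :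
    turns e (i + m) = turns e i ∧ abscissa e (i + m) = abscissa e i + m * (-1) ^ turns e i := by
  induction m with
  | zero => simp
  | succ m ih =>
    obtain ⟨h1, h2⟩ := ih fun k hk hk' => he k hk (by omega)
    have h0 : e (i + m) = 0 := he _ (by omega) (by omega)
    rw [← add_assoc, turns, abscissa, if_pos h0, if_pos h0, h1, h2]
    refine ⟨rfl, ?_⟩
    push_cast
    ring

/-- Vertices at equal height have no turn between them, so they lie on one straight run, along which
the abscissa never repeats. -/
theorem zigzag_injective (e : ℕ → ℕ) : Function.Injective (zigzag e) := by
  have key : ∀ i j, i < j → zigzag e i ≠ zigzag e j := by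
    intro i j hij h
    simp only [zigzag, Prod.mk.injEq, Nat.cast_inj] at h
    obtain ⟨m, rfl⟩ := Nat.exists_eq_add_of_lt hij
    have h0 : ∀ k, i ≤ k → k < i + (m + 1) → e k = 0 := by
      intro k hk hk'
      by_contra hne
      have h1 := turns_mono e hk
      have h2 := turns_mono e (show k + 1 ≤ i + m + 1 by omega)
      simp only [turns, hne, if_false] at h2
      have h3 := h.2
      simp only [turns] at h3
      omega
    have h1 := (straight h0).2
    rw [← add_assoc, ← h.1] at h1
    have h2 : ((m + 1 : ℕ) : ℤ) * (-1) ^ turns e i = 0 := by linarith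
    rcases mul_eq_zero.1 h2 with h3 | h3
    · omega
    · exact absurd h3 (pow_ne_zero _ (by norm_num))
  intro i j h
  rcases lt_trichotomy i j with hij | hij | hij
  · exact absurd h (key i j hij)
  · exact hij
  · exact absurd h.symm (key j i hij)

theorem gridStep_zigzag_zero {e : ℕ → ℕ} {k : ℕ} (h : e k = 0) :
    gridStep (zigzag e) k = ((-1) ^ turns e k, 0) := by
  simp [gridStep, zigzag, turns, abscissa, h]

theorem gridStep_zigzag_pos {e : ℕ → ℕ} {k : ℕ} (h : 0 < e k) :
    gridStep (zigzag e) k = (0, 1) := by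
  simp [gridStep, zigzag, turns, abscissa, h.ne']

theorem isGridPath_zigzag (N : ℕ) (e : ℕ → ℕ) : IsGridPath N (zigzag e) := by
  refine ⟨fun i j _ _ h => zigzag_injective e h, fun i _ => ?_⟩
  rcases Nat.eq_zero_or_pos (e i) with h | h
  · simp only [GridAdj, zigzag, turns, abscissa, h, if_true]
    rcases neg_one_pow_eq_or ℤ (turns e i) with h' | h' <;> simp [h']
  · simp [GridAdj, zigzag, turns, abscissa, h.ne']

/-- The embedding depends on `e` only, the current graph on `e'`, so the replacements do not
interfere. Around `k` the zigzag runs straight for `e k` steps, turns, and runs back for `e k`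
steps; both extremities have the same abscissa, at heights differing by one. -/
theorem elementaryTransformation_offset {N : ℕ} {e e' : ℕ → ℕ} (he : IsOffset N e)
    {k : ℕ} (hk : 0 < e k) (hk' : e' k = 0) :
    ElementaryTransformation N (zigzag e) (offsetGraph N e')
      (offsetGraph N (Function.update e' k (e k))) := by
  obtain ⟨h1, h2⟩ := he.1 k hk
  have h0 : ∀ j, k ≤ j + e k → j ≤ k + e k → j ≠ k → e j = 0 := by
    intro j hj hj' hne
    by_contra h
    have := he.2 k j hk (Nat.pos_of_ne_zero h) hne
    omega
  obtain ⟨c, rfl⟩ : ∃ c, k = c + 1 := ⟨k - 1, by omega⟩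
  have hback := straight (e := e) (i := c + 1 - e (c + 1)) (m := e (c + 1))
    fun j hj hj' => h0 j (by omega) (by omega) (by omega)
  have hforth := straight (e := e) (i := c + 2) (m := e (c + 1))
    fun j hj hj' => h0 j (by omega) (by omega) (by omega)
  rw [Nat.sub_add_cancel h1] at hback
  have ht : turns e (c + 2) = turns e (c + 1) + 1 := by
    simp only [turns, hk.ne', if_false]
  have ha : abscissa e (c + 2) = abscissa e (c + 1) := by
    rw [abscissa, if_neg hk.ne']
  refine ⟨c, by omega, ⟨c + 1 - e (c + 1), by omega⟩, ⟨c + 2 + e (c + 1), by omega⟩,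
    ?_, ?_, ⟨by simp, ?_⟩, ⟨by simp, ?_⟩, ?_, ?_, ?_⟩
  · rw [gridStep_zigzag_pos hk, gridStep_zigzag_zero (h0 c (by omega) (by omega) (by omega))]
    simp
  · rw [gridStep_zigzag_pos hk, gridStep_zigzag_zero (h0 (c + 2) (by omega) (by omega) (by omega))]
    simp
  · intro i hi hi'
    simp only at hi
    have hz : ∀ j, i ≤ j → j < i + (c - i) → e j = 0 :=
      fun j hj hj' => h0 j (by omega) (by omega) (by omega)
    have h3 := (straight hz).1
    rw [show i + (c - i) = c by omega] at h3
    rw [gridStep_zigzag_zero (h0 i (by omega) (by omega) (by omega)),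
      gridStep_zigzag_zero (h0 c (by omega) (by omega) (by omega)), h3]
  · intro i hi hi'
    simp only at hi'
    have hz : ∀ j, c + 2 ≤ j → j < c + 2 + (i - (c + 2)) → e j = 0 :=
      fun j hj hj' => h0 j (by omega) (by omega) (by omega)
    have h3 := (straight hz).1
    rw [show c + 2 + (i - (c + 2)) = i by omega] at h3
    rw [gridStep_zigzag_zero (h0 i (by omega) (by omega) (by omega)),
      gridStep_zigzag_zero (h0 (c + 2) (by omega) (by omega) (by omega)), h3]
  · simp only [GridAdj, zigzag, hforth.1, hforth.2, ht, ha, hback.2]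
    rw [← hback.1, pow_succ]
    push_cast
    ring_nf
    simp
  · exact ⟨c + 1, by simp [hk']⟩
  · ext x y
    have hx := x.2
    have hy := y.2
    simp only [SimpleGraph.sup_adj, SimpleGraph.deleteEdges_adj, SimpleGraph.edge_adj,
      Set.mem_singleton_iff, Sym2.eq_iff, Fin.ext_iff, ne_eq]
    constructor
    · rintro ⟨j, hj⟩
      by_cases hjk : j = c + 1
      · subst hjk
        simp only [Function.update_self] at hj
        right; omega
      · rw [Function.update_of_ne hjk] at hj
        exact Or.inl ⟨⟨j, hj⟩, by omega⟩
    · rintro (⟨⟨j, hj⟩, hne⟩ | hj)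
      · refine ⟨j, ?_⟩
        rw [Function.update_of_ne]
        · exact hj
        · rintro rfl; omega
      · exact ⟨c + 1, by simp only [Function.update_self]; omega⟩

theorem isPathLike_offsetGraph {V : Type*} {T : SimpleGraph V} {N : ℕ} {e : ℕ → ℕ}
    (he : IsOffset N e) (hT : Nonempty (T ≃g offsetGraph N e)) : IsPathLike T := by
  refine ⟨N, zigzag e, offsetGraph N e, isGridPath_zigzag N e, ?_, hT⟩
  -- `D` is the set of edges already replaced; the embedding is that of the full `e` throughout.
  have key : ∀ D : Finset ℕ, Relation.ReflTransGen (ElementaryTransformation N (zigzag e))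
      (SimpleGraph.pathGraph N) (offsetGraph N (fun k => if k ∈ D then e k else 0)) := by
    intro D
    induction D using Finset.induction_on with
    | empty => simp [offsetGraph_zero, Relation.ReflTransGen.refl]
    | insert k D hk ih =>
      have hupd : (fun j => if j ∈ insert k D then e j else 0) =
          Function.update (fun j => if j ∈ D then e j else 0) k (e k) := by
        ext j
        by_cases hj : j = k
        · subst hj; simp
        · simp [hj]
      rw [hupd]
      rcases Nat.eq_zero_or_pos (e k) with h | h
      · rwa [h, Function.update_eq_self_iff.2]
        simp [hk]
      · exact ih.tail (elementaryTransformation_offset he h (by simp [hk]))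
  have hall : (fun k => if k ∈ Finset.range N then e k else 0) = e := by
    ext k
    by_cases h : e k = 0
    · simp [h]
    · have := he.1 k (Nat.pos_of_ne_zero h)
      simp [show k < N by omega]
  have := key (Finset.range N)
  rwa [hall] at this

/-! ### Configurations built row by row -/

/-- `Built Q S R`: a sequence of rows with last row `R` covers `S`; consecutive elements of a row are
related by `Q`, and so are one element of each row and the element of the next row whose distance
from the start is the distance of the former from the end. -/
inductive Built {W : Type*} (Q : W → W → Prop) : Set W → List W → Prop
  | start (R : List W) (hne : R ≠ []) (hnd : R.Nodup) (hch : R.IsChain Q) : Built Q {z | z ∈ R} R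
  | step (S : Set W) (A B A' B' : List W) (x y : W) (h : Built Q S (A ++ x :: B))
      (hnd : (A' ++ y :: B').Nodup) (hch : (A' ++ y :: B').IsChain Q)
      (hS : ∀ z ∈ A' ++ y :: B', z ∉ S) (hlen : B.length = A'.length) (hxy : Q x y) :
      Built Q (S ∪ {z | z ∈ A' ++ y :: B'}) (A' ++ y :: B')

/-- Concatenate the rows. The vanishing of the offsets inside the last row is the invariant that
keeps the replaced edges apart: the offset at a new break reaches back only within that row. -/
theorem Built.exists_numbering {W : Type*} {Q : W → W → Prop} {S : Set W} {R : List W}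
    (h : Built Q S R) : ∃ (N : ℕ) (e : ℕ → ℕ) (x : ℕ → W), IsOffset N e ∧ R.length ≤ N ∧
      (∀ k, N ≤ k + R.length → e k = 0) ∧
      (∀ j (hj : j < R.length), x (N - R.length + j) = R[j]) ∧
      Set.InjOn x (Set.Iio N) ∧ x '' Set.Iio N = S ∧
      ∀ k, k + 1 < N → Q (x (k - e k)) (x (k + 1 + e k)) := by
  induction h with
  | start R hne hnd hch =>
    obtain ⟨w, l, rfl⟩ := List.exists_cons_of_ne_nil hne
    have hx : ∀ j (hj : j < (w :: l).length), (w :: l).getD j w = (w :: l)[j] :=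
      fun j hj => by simp [List.getD_eq_getElem?_getD, List.getElem?_eq_getElem hj]
    refine ⟨(w :: l).length, fun _ => 0, fun j => (w :: l).getD j w, ⟨by simp, by simp⟩, le_rfl,
      fun _ _ => rfl, ?_, ?_, ?_, ?_⟩
    · intro j hj
      simpa using hx j hj
    · intro i hi j hj hij
      simp only [hx i hi, hx j hj] at hij
      exact (hnd.getElem_inj_iff).1 hij
    · ext z
      constructor
      · rintro ⟨j, hj, rfl⟩
        simp only [hx j hj, Set.mem_ofPred_eq]
        exact List.getElem_mem _
      · intro hz
        obtain ⟨j, hj, rfl⟩ := List.mem_iff_getElem.1 hz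
        exact ⟨j, hj, hx j hj⟩
    · intro k hk
      simp only [Nat.sub_zero, Nat.add_zero, hx k (by omega), hx (k + 1) hk]
      exact List.isChain_iff_getElem.1 hch k hk
  | step S A B A' B' u v h hnd hch hS hlen huv ih =>
    obtain ⟨N, e, x, he, hN, h0, hR, hinj, himg, hQ⟩ := ih
    set R' := A' ++ v :: B' with hR'
    have hlen' : R'.length = A'.length + 1 + B'.length := by simp [hR']; omega
    have hlen1 : (A ++ u :: B).length = A.length + 1 + B.length := by simp; omega
    set x' : ℕ → W := fun k => if k < N then x k else R'.getD (k - N) u with hx'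
    have hlt : ∀ k, k < N → x' k = x k := fun k hk => by simp [hx', hk]
    have hge : ∀ j (hj : j < R'.length), x' (N + j) = R'[j] := fun j hj => by
      simp [hx', List.getD_eq_getElem?_getD, List.getElem?_eq_getElem hj]
    -- The new break is `{N - 1, N}`; its offset is the number of vertices after `u`, which equals
    -- the number before `v`.
    set e' : ℕ → ℕ := fun k => if k + 1 = N then B.length else e k with he'
    have hek : ∀ k, 0 < e k → k + (A ++ u :: B).length < N := fun k hk => by
      by_contra hc
      rw [h0 k (by omega)] at hk
      exact lt_irrefl _ hk
    refine ⟨N + R'.length, e', x', ⟨?_, ?_⟩, by omega, ?_, ?_, ?_, ?_, ?_⟩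
    · intro k hk
      by_cases hkN : k + 1 = N
      · simp only [he', hkN, if_true] at hk ⊢
        omega
      · simp only [he', hkN, if_false] at hk ⊢
        have := he.1 k hk
        omega
    · intro k k' hk hk' hne
      by_cases hkN : k + 1 = N
      · have hkN' : k' + 1 ≠ N := by omega
        simp only [he', hkN', if_false] at hk'
        simp only [he', hkN, if_true]
        have := hek k' hk'
        omega
      · simp only [he', hkN, if_false] at hk ⊢
        have h1 := he.1 k hk
        by_cases hkN' : k' + 1 = N
        · omega
        · simp only [he', hkN', if_false] at hk'
          exact he.2 k k' hk hk' hne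
    · intro k hk
      simp only [he', show k + 1 ≠ N by omega, if_false]
      exact h0 k (by omega)
    · intro j hj
      rw [Nat.add_sub_cancel]
      exact hge j hj
    · have hcross : ∀ i j, i < N → j < R'.length → x' i ≠ x' (N + j) := by
        intro i j hi hj hij
        rw [hlt i hi, hge j hj] at hij
        refine hS _ (List.getElem_mem hj) ?_
        rw [← hij, ← himg]
        exact ⟨i, hi, rfl⟩
      intro i hi j hj hij
      simp only [Set.mem_Iio] at hi hj
      rcases lt_or_ge i N with hi' | hi' <;> rcases lt_or_ge j N with hj' | hj'
      · rw [hlt i hi', hlt j hj'] at hij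
        exact hinj hi' hj' hij
      · obtain ⟨m, rfl⟩ := Nat.exists_eq_add_of_le hj'
        exact absurd hij (hcross i m hi' (by omega))
      · obtain ⟨m, rfl⟩ := Nat.exists_eq_add_of_le hi'
        exact absurd hij.symm (hcross j m hj' (by omega))
      · obtain ⟨m, rfl⟩ := Nat.exists_eq_add_of_le hi'
        obtain ⟨m', rfl⟩ := Nat.exists_eq_add_of_le hj'
        rw [hge m (by omega), hge m' (by omega)] at hij
        rw [(hnd.getElem_inj_iff).1 hij]
    · ext z
      constructor
      · rintro ⟨k, hk, rfl⟩
        simp only [Set.mem_Iio] at hk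
        rcases lt_or_ge k N with hk' | hk'
        · left
          rw [hlt k hk', ← himg]
          exact ⟨k, hk', rfl⟩
        · obtain ⟨m, rfl⟩ := Nat.exists_eq_add_of_le hk'
          right
          rw [hge m (by omega)]
          exact List.getElem_mem _
      · rintro (hz | hz)
        · rw [← himg] at hz
          obtain ⟨k, hk, rfl⟩ := hz
          simp only [Set.mem_Iio] at hk
          exact ⟨k, by simp only [Set.mem_Iio]; omega, hlt k hk⟩
        · obtain ⟨j, hj, rfl⟩ := List.mem_iff_getElem.1 hz
          exact ⟨N + j, by simp only [Set.mem_Iio]; omega, hge j hj⟩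
    · intro k hk
      by_cases hkN : k + 1 = N
      · have h1 : x' (k - B.length) = u := by
          rw [hlt _ (by omega), show k - B.length = N - (A ++ u :: B).length + A.length by omega,
            hR A.length (by omega)]
          simp
        have h2 : x' (k + 1 + B.length) = v := by
          rw [hkN, hlen, hge _ (by omega)]
          simp [hR']
        simp only [he', hkN, if_true]
        rw [← hkN, h1, h2]
        exact huv
      · simp only [he', hkN, if_false]
        rcases lt_or_ge (k + 1) N with hk' | hk'
        · have h3 : k + 1 + e k < N := by
            rcases Nat.eq_zero_or_pos (e k) with h4 | h4
            · omega
            · exact (he.1 k h4).2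
          rw [hlt _ (by omega), hlt _ h3]
          exact hQ k hk'
        · obtain ⟨m, rfl⟩ := Nat.exists_eq_add_of_le (show N ≤ k by omega)
          rw [h0 _ (by omega), Nat.sub_zero, Nat.add_zero, add_assoc, hge m (by omega),
            hge (m + 1) (by omega)]
          exact List.isChain_iff_getElem.1 hch m (by omega)

/-- Edge counting: each of the `N - 1` edges of the offset graph is the parent edge of a non-root
vertex. This assignment is injective between sets of equal size, hence every parent edge, and so
every edge of `T`, is already there. -/
theorem eq_offsetGraph {N : ℕ} {e : ℕ → ℕ} (he : IsOffset N e) {T : SimpleGraph (Fin N)}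
    (hle : offsetGraph N e ≤ T) (root : Fin N) (par : Fin N → Fin N)
    (hpar : ∀ x y, T.Adj x y → (x ≠ root ∧ y = par x) ∨ (y ≠ root ∧ x = par y)) :
    T = offsetGraph N e := by
  have hlt : ∀ k, k + 1 < N → e k ≤ k ∧ k + 1 + e k < N := by
    intro k hk
    rcases Nat.eq_zero_or_pos (e k) with h | h
    · omega
    · exact he.1 k h
  have hchild : ∀ k : Fin (N - 1), ∃ c : {x : Fin N // x ≠ root},
      (c.1.val + e k = k ∧ (par c.1).val = k + 1 + e k) ∨
        ((par c.1).val + e k = k ∧ c.1.val = k + 1 + e k) := by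
    intro k
    obtain ⟨h1, h2⟩ := hlt k (by omega)
    have hadj : T.Adj ⟨k - e k, by omega⟩ ⟨k + 1 + e k, h2⟩ :=
      hle ⟨k, Or.inl ⟨by simp only; omega, rfl⟩⟩
    rcases hpar _ _ hadj with ⟨hr, hp⟩ | ⟨hr, hp⟩
    · exact ⟨⟨_, hr⟩, Or.inl ⟨by simp only; omega, by rw [← hp]⟩⟩
    · exact ⟨⟨_, hr⟩, Or.inr ⟨by rw [← hp]; simp only; omega, rfl⟩⟩
  choose ch hch using hchild
  -- The ends of the `k`-th edge sum to `2 * k + 1`, so the child determines `k`.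
  have hinj : Function.Injective ch := by
    intro k k' hk
    have h1 := hch k
    have h2 := hch k'
    rw [hk] at h1
    ext
    omega
  have hbij : Function.Bijective ch := by
    rw [Fintype.bijective_iff_injective_and_card]
    refine ⟨hinj, ?_⟩
    rw [Fintype.card_fin, Fintype.card_subtype_compl]
    simp
  refine le_antisymm (fun x y hxy => ?_) hle
  have key : ∀ x, x ≠ root → (offsetGraph N e).Adj x (par x) := by
    intro x hx
    obtain ⟨k, hk⟩ := hbij.2 ⟨x, hx⟩
    have h1 := hch k
    rw [hk] at h1
    exact ⟨k, h1⟩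
  rcases hpar x y hxy with ⟨hr, rfl⟩ | ⟨hr, rfl⟩
  · exact key x hr
  · exact (key y hr).symm

/-- A graph with at most one edge for every vertex other than `root` is path-like if its vertices can
be arranged in rows along its edges. -/
theorem Built.isPathLike {W V : Type*} {Q : W → W → Prop} {S : Set W} {R : List W}
    (h : Built Q S R) {T : SimpleGraph V} (ψ : S ≃ V)
    (hQ : ∀ x y : S, Q x y → T.Adj (ψ x) (ψ y)) (root : V) (par : V → V)
    (hpar : ∀ x y, T.Adj x y → (x ≠ root ∧ y = par x) ∨ (y ≠ root ∧ x = par y)) :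
    IsPathLike T := by
  obtain ⟨N, e, x, he, -, -, -, hinj, himg, hx⟩ := h.exists_numbering
  have hmem : ∀ i : Fin N, x i ∈ S := fun i => himg ▸ ⟨i, i.2, rfl⟩
  let χ : Fin N ≃ V := (Equiv.ofBijective (fun i : Fin N => (⟨x i, hmem i⟩ : S)) (by
    constructor
    · intro i j hij
      exact Fin.ext (hinj i.2 j.2 (Subtype.ext_iff.1 hij))
    · rintro ⟨z, hz⟩
      rw [← himg] at hz
      obtain ⟨k, hk, rfl⟩ := hz
      exact ⟨⟨k, hk⟩, rfl⟩)).trans ψ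
  have hχ : ∀ i j : Fin N, Q (x i) (x j) → T.Adj (χ i) (χ j) := fun i j => hQ ⟨x i, hmem i⟩ ⟨x j, hmem j⟩
  have hle : offsetGraph N e ≤ T.comap χ := by
    have key : ∀ (i j : Fin N) k, i.val + e k = k → j.val = k + 1 + e k → T.Adj (χ i) (χ j) := by
      intro i j k h1 h2
      apply hχ
      have := hx k (by omega)
      rwa [← h2, show k - e k = i.val by omega] at this
    rintro i j ⟨k, ⟨h1, h2⟩ | ⟨h1, h2⟩⟩
    · exact key i j k h1 h2
    · exact (key j i k h1 h2).symm
  have heq := eq_offsetGraph he hle (χ.symm root) (fun i => χ.symm (par (χ i))) (by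
    intro i j hij
    rcases hpar _ _ hij with ⟨h1, h2⟩ | ⟨h1, h2⟩
    · left
      exact ⟨fun hc => h1 (by simp [hc]), by simp [← h2]⟩
    · right
      exact ⟨fun hc => h1 (by simp [hc]), by simp [← h2]⟩)
  refine isPathLike_offsetGraph he ⟨?_⟩
  rw [← heq]
  exact (SimpleGraph.Iso.comap χ T).symm

/-! ### Segments and ports -/

section Rows

variable {W : Type*} {Q : W → W → Prop}

/-- The list `y s, …, y (s + m - 1)`. -/
def seg (y : ℕ → W) (s m : ℕ) : List W := (List.range' s m).map y

@[simp] theorem length_seg (y : ℕ → W) (s m : ℕ) : (seg y s m).length = m := by simp [seg]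

theorem mem_seg {y : ℕ → W} {s m : ℕ} {z : W} :
    z ∈ seg y s m ↔ ∃ k, (s ≤ k ∧ k < s + m) ∧ y k = z := by
  simp [seg, List.mem_range'_1]

theorem getElem?_seg {y : ℕ → W} {s m k : ℕ} (hk : k < m) : (seg y s m)[k]? = some (y (s + k)) := by
  simp [seg, hk]

theorem getElem?_reverse_seg {y : ℕ → W} {s m k : ℕ} (hk : k < m) :
    (seg y s m).reverse[k]? = some (y (s + (m - 1 - k))) := by
  rw [List.getElem?_reverse (by simpa using hk), length_seg, getElem?_seg (by omega)]

theorem nodup_seg {y : ℕ → W} {s m : ℕ} (hy : Set.InjOn y (Set.Ico s (s + m))) :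
    (seg y s m).Nodup := by
  refine (List.nodup_map_iff_inj_on (List.nodup_range' (h := by omega))).2 fun i hi j hj hij => ?_
  rw [List.mem_range'_1] at hi hj
  exact hy hi hj hij

theorem isChain_seg {y : ℕ → W} {s m : ℕ}
    (hy : ∀ k, s ≤ k → k + 1 < s + m → Q (y k) (y (k + 1))) : (seg y s m).IsChain Q := by
  rw [List.isChain_iff_getElem]
  intro i hi
  rw [length_seg] at hi
  simpa [seg, add_assoc] using hy (s + i) (by omega) (by omega)

theorem isChain_reverse_seg (hQ : ∀ x y, Q x y → Q y x) {y : ℕ → W} {s m : ℕ}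
    (hy : ∀ k, s ≤ k → k + 1 < s + m → Q (y k) (y (k + 1))) : (seg y s m).reverse.IsChain Q := by
  rw [List.isChain_reverse]
  exact isChain_seg fun k hk hk' => hQ _ _ (hy k hk hk')

theorem isChain_append_of {l l' : List W} (h : l.IsChain Q) (h' : l'.IsChain Q)
    (hj : ∀ x y, l[l.length - 1]? = some x → l'[0]? = some y → Q x y) : (l ++ l').IsChain Q := by
  refine List.isChain_append.2 ⟨h, h', fun x hx y hy => hj x y ?_ ?_⟩
  · rwa [← List.getLast?_eq_getElem?]
  · rwa [← List.head?_eq_getElem?]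

theorem nodup_append_of {l l' : List W} (h : l.Nodup) (h' : l'.Nodup)
    (hd : ∀ z, z ∈ l → z ∉ l') : (l ++ l').Nodup :=
  List.nodup_append.2 ⟨h, h', fun z hz _ hz' he => hd z hz (he ▸ hz')⟩

/-- `S` is covered by rows so that `x` belongs to the last one, at distance `d - 1` from its end. -/
def Port (Q : W → W → Prop) (S : Set W) (x : W) (d : ℕ) : Prop :=
  ∃ R, Built Q S R ∧ 1 ≤ d ∧ d ≤ R.length ∧ R[R.length - d]? = some x

theorem Built.port {S : Set W} {R : List W} (h : Built Q S R) {x : W} {k d : ℕ}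
    (hk : R[k]? = some x) (hd : k + d = R.length) : Port Q S x d := by
  have hlt : k < R.length := by
    by_contra hc
    rw [List.getElem?_eq_none (by omega)] at hk
    exact absurd hk (by simp)
  exact ⟨R, h, by omega, by omega, by rwa [show R.length - d = k by omega]⟩

theorem Built.start_of {S : Set W} {R : List W} (hne : R ≠ []) (hnd : R.Nodup) (hch : R.IsChain Q)
    (hS : ∀ z, z ∈ S ↔ z ∈ R) : Built Q S R := by
  obtain rfl : S = {z | z ∈ R} := Set.ext hS
  exact Built.start R hne hnd hch

theorem split_of_getElem? {R : List W} {k : ℕ} {x : W} (h : R[k]? = some x) :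
    ∃ A B, R = A ++ x :: B ∧ A.length = k := by
  obtain ⟨hk, hx⟩ := List.getElem?_eq_some_iff.1 h
  refine ⟨R.take k, R.drop (k + 1), ?_, by simp; omega⟩
  rw [← hx, List.cons_getElem_drop_succ, List.take_append_drop]

/-- Both `x` and `y` are `d - 1` steps away from the break between their rows, as `Built.step`
demands. -/
theorem Port.step {S S' : Set W} {x y : W} {d : ℕ} {R : List W} (h : Port Q S x d)
    (hy : R[d - 1]? = some y) (hxy : Q x y) (hnd : R.Nodup) (hch : R.IsChain Q)
    (hdisj : ∀ z, z ∈ R → z ∉ S) (hS : ∀ z, z ∈ S' ↔ z ∈ S ∨ z ∈ R) : Built Q S' R := by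
  obtain ⟨R₀, h₀, hd, hd', hx⟩ := h
  obtain ⟨A, B, rfl, hA⟩ := split_of_getElem? hx
  obtain ⟨A', B', rfl, hA'⟩ := split_of_getElem? hy
  obtain rfl : S' = S ∪ {z | z ∈ A' ++ y :: B'} := Set.ext hS
  simp only [List.length_append, List.length_cons] at hA hd'
  exact Built.step S A B A' B' x y h₀ hnd hch hdisj (by omega) hxy

/-- A path whose length is a multiple of `d` can be appended in rows of length `d`. -/
theorem Port.snake (hQ : ∀ x y, Q x y → Q y x) {y : ℕ → W} {St : ℕ → Set W} {p t d : ℕ}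
    (h : Port Q (St p) (y p) d) (hpt : p ≤ t) (hd : d ∣ t - p)
    (hadj : ∀ k, p ≤ k → k < t → Q (y k) (y (k + 1)))
    (hSt : ∀ p' p'', p ≤ p' → p' ≤ p'' → p'' ≤ t →
      ∀ z, z ∈ St p'' ↔ z ∈ St p' ∨ z ∈ seg y (p' + 1) (p'' - p'))
    (hdisj : ∀ p' k, p ≤ p' → p' < k → k ≤ t → y k ∉ St p') :
    Port Q (St t) (y t) d ∧
      (p < t → d ≤ t - p ∧ Built Q (St t) (seg y (t - d + 1) d).reverse) := by
  have hpos : 1 ≤ d := by obtain ⟨R, -, h1, -⟩ := h; exact h1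
  have hinj : Set.InjOn y (Set.Ioc p t) := by
    have key : ∀ i j, p < i → i < j → j ≤ t → y i ≠ y j := by
      intro i j hi hij hj heq
      refine hdisj i j hi.le hij hj ?_
      rw [← heq, hSt (i - 1) i (by omega) (by omega) (by omega)]
      exact Or.inr (mem_seg.2 ⟨i, by omega, rfl⟩)
    rintro i ⟨hi, hi'⟩ j ⟨hj, hj'⟩ hij
    rcases lt_trichotomy i j with hlt | hlt | hlt
    · exact absurd hij (key i j hi hlt hj')
    · exact hlt
    · exact absurd hij.symm (key j i hj hlt hi')
  -- Reversal puts `y (q + 1)` at index `d - 1`, matching `y q`, and `y (q + d)` at index `0`, so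
  -- the same `d` serves for the next row.
  have hstep : ∀ q, p ≤ q → q + d ≤ t → Port Q (St q) (y q) d →
      Built Q (St (q + d)) (seg y (q + 1) d).reverse := by
    intro q hq hqt hport
    refine hport.step (y := y (q + 1)) ?_ (hadj q hq (by omega)) ?_ ?_ ?_ ?_
    · rw [getElem?_reverse_seg (by omega)]
      congr 2
      omega
    · rw [List.nodup_reverse]
      exact nodup_seg fun i hi j hj => hinj ⟨by have := hi.1; omega, by have := hi.2; omega⟩
        ⟨by have := hj.1; omega, by have := hj.2; omega⟩
    · exact isChain_reverse_seg hQ fun k hk hk' => hadj k (by omega) (by omega)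
    · intro z hz
      rw [List.mem_reverse, mem_seg] at hz
      obtain ⟨k, ⟨hk, hk'⟩, rfl⟩ := hz
      exact hdisj q k hq (by omega) (by omega)
    · intro z
      rw [List.mem_reverse, hSt q (q + d) hq (by omega) hqt, Nat.add_sub_cancel_left]
  obtain ⟨m, hm⟩ := hd
  have main : ∀ m, p + d * m ≤ t → Port Q (St (p + d * m)) (y (p + d * m)) d ∧
      (0 < m → Built Q (St (p + d * m)) (seg y (p + d * m - d + 1) d).reverse) := by
    intro m
    induction m with
    | zero => intro _; simpa using h
    | succ m ih =>
      intro hm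
      rw [Nat.mul_succ, ← add_assoc] at hm ⊢
      have hb := hstep (p + d * m) (by omega) hm (ih (by omega)).1
      refine ⟨hb.port (k := 0) ?_ (by simp), fun _ => ?_⟩
      · rw [getElem?_reverse_seg (by omega)]
        congr 2
        omega
      · rwa [Nat.add_sub_cancel]
  obtain rfl : t = p + d * m := by omega
  refine ⟨(main m le_rfl).1, fun hlt => ?_⟩
  have hmpos : 0 < m := Nat.pos_of_ne_zero fun h0 => by simp [h0] at hlt
  exact ⟨by rw [Nat.add_sub_cancel_left]; exact Nat.le_mul_of_pos_right d hmpos,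
    (main m le_rfl).2 hmpos⟩

end Rows

/-! ### The rows of a ladder -/

/-- The vertices of the `i`-th horizontal path. -/
def hv (i j : ℕ) : GridName := Sum.inl (i, j)

/-- The vertices of the `i`-th vertical path of the tree in `𝓗_n` with parameters `(h; r; a, b)`. -/
abbrev vv (h r a b : ℕ → ℕ) (i : ℕ) : ℕ → GridName :=
  verticalVertex r (fun i => h i - a i + 1) b i

/-- `Q` contains the edges of the tree in `𝓗_n` with parameters `(h; r; a, b)`. -/
structure IsLadder (Q : GridName → GridName → Prop) (n : ℕ) (h r a b : ℕ → ℕ) : Prop where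
  symm : ∀ x y, Q x y → Q y x
  param : IsHnParam n h r a b
  horizontal : ∀ i j, 1 ≤ i → i ≤ n → 1 ≤ j → j < h i → Q (hv i j) (hv i (j + 1))
  vertical : ∀ i j, 1 ≤ i → i < n → j < r i →
    Q (vv h r a b i j) (vv h r a b i (j + 1))

/-- The vertices of the first `i - 1` horizontal and vertical paths, the first `c` vertices of the
`i`-th horizontal path and the first `q` interior vertices of the `i`-th vertical path. -/
def stage (h r : ℕ → ℕ) (i c q : ℕ) : Set GridName :=
  {z | match z with
    | Sum.inl (i', j) => 1 ≤ i' ∧ 1 ≤ j ∧ (i' < i ∧ j ≤ h i' ∨ i' = i ∧ j ≤ c)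
    | Sum.inr (i', j) => 1 ≤ i' ∧ 1 ≤ j ∧ (i' < i ∧ j < r i' ∨ i' = i ∧ j ≤ q)}

theorem inl_mem_stage {h r : ℕ → ℕ} {i c q i' j : ℕ} : Sum.inl (i', j) ∈ stage h r i c q ↔
    1 ≤ i' ∧ 1 ≤ j ∧ (i' < i ∧ j ≤ h i' ∨ i' = i ∧ j ≤ c) := Iff.rfl

theorem inr_mem_stage {h r : ℕ → ℕ} {i c q i' j : ℕ} : Sum.inr (i', j) ∈ stage h r i c q ↔
    1 ≤ i' ∧ 1 ≤ j ∧ (i' < i ∧ j < r i' ∨ i' = i ∧ j ≤ q) := Iff.rfl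

theorem inl_mem_hseg {i s m i' j : ℕ} :
    (Sum.inl (i', j) : GridName) ∈ seg (hv i) s m ↔ i' = i ∧ s ≤ j ∧ j < s + m := by
  rw [mem_seg]
  simp only [hv, Sum.inl.injEq, Prod.mk.injEq]
  constructor
  · rintro ⟨k, hk, rfl, rfl⟩; exact ⟨rfl, hk⟩
  · rintro ⟨rfl, hk⟩; exact ⟨j, hk, rfl, rfl⟩

theorem inr_mem_hseg {i s m i' j : ℕ} :
    (Sum.inr (i', j) : GridName) ∈ seg (hv i) s m ↔ False := by
  rw [mem_seg]
  simp [hv]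

theorem nodup_hseg (i s m : ℕ) : (seg (hv i) s m).Nodup :=
  nodup_seg fun _ _ _ _ h => by simpa [hv] using h

section Vertical

variable {r p q : ℕ → ℕ} {i : ℕ}

theorem verticalVertex_zero : verticalVertex r p q i 0 = hv i (p i) := by
  simp [verticalVertex, hv]

theorem verticalVertex_last (hr : 1 ≤ r i) : verticalVertex r p q i (r i) = hv (i + 1) (q i) := by
  simp [verticalVertex, hv, show r i ≠ 0 by omega]

theorem verticalVertex_inner {j : ℕ} (hj : 1 ≤ j) (hj' : j < r i) :
    verticalVertex r p q i j = Sum.inr (i, j) := by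
  simp [verticalVertex, show j ≠ 0 by omega, show j ≠ r i by omega]

theorem inl_mem_vseg {s m i' j : ℕ} (hr : 1 ≤ r i) (hs : s + m ≤ r i + 1) :
    Sum.inl (i', j) ∈ seg (verticalVertex r p q i) s m ↔
      0 < m ∧ (i' = i ∧ j = p i ∧ s = 0 ∨ i' = i + 1 ∧ j = q i ∧ s + m = r i + 1) := by
  rw [mem_seg]
  constructor
  · rintro ⟨k, hk, he⟩
    unfold verticalVertex at he
    split_ifs at he with h1 h2
    · simp only [Sum.inl.injEq, Prod.mk.injEq] at he
      omega
    · simp only [Sum.inl.injEq, Prod.mk.injEq] at he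
      omega
  · rintro ⟨hm, ⟨rfl, rfl, rfl⟩ | ⟨rfl, rfl, h⟩⟩
    · exact ⟨0, by omega, verticalVertex_zero⟩
    · exact ⟨r i, by omega, verticalVertex_last hr⟩

theorem inr_mem_vseg {s m i' j : ℕ} :
    Sum.inr (i', j) ∈ seg (verticalVertex r p q i) s m ↔
      i' = i ∧ s ≤ j ∧ j < s + m ∧ 1 ≤ j ∧ j ≠ r i := by
  rw [mem_seg]
  constructor
  · rintro ⟨k, hk, he⟩
    unfold verticalVertex at he
    split_ifs at he with h1 h2
    simp only [Sum.inr.injEq, Prod.mk.injEq] at he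
    omega
  · rintro ⟨rfl, h1, h2, h3, h4⟩
    exact ⟨j, ⟨h1, h2⟩, by simp [verticalVertex, show j ≠ 0 by omega, h4]⟩

theorem nodup_vseg {s m : ℕ} : (seg (verticalVertex r p q i) s m).Nodup := by
  refine nodup_seg fun k _ k' _ h => ?_
  unfold verticalVertex at h
  split_ifs at h <;> simp only [Sum.inl.injEq, Sum.inr.injEq, Prod.mk.injEq] at h <;>
    omega

end Vertical

namespace IsLadder

variable {Q : GridName → GridName → Prop} {n : ℕ} {h r a b : ℕ → ℕ}

/-- The `i`-th horizontal path is completed in rows of length `d`. -/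
theorem hsnake (L : IsLadder Q n h r a b) {i c t d : ℕ} (hi : 1 ≤ i) (hin : i ≤ n)
    (hc : 1 ≤ c) (hct : c ≤ t) (hth : t ≤ h i) (hd : d ∣ t - c)
    (hp : Port Q (stage h r i c 0) (hv i c) d) :
    Port Q (stage h r i t 0) (hv i t) d ∧
      (c < t → d ≤ t - c ∧ Built Q (stage h r i t 0) (seg (hv i) (t - d + 1) d).reverse) := by
  refine Port.snake (St := fun c => stage h r i c 0) L.symm hp hct hd
    (fun k hk hk' => L.horizontal i k hi hin (by omega) (by omega)) ?_ ?_
  · rintro p' p'' h1 h2 h3 (⟨i', j⟩ | ⟨i', j⟩)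
    · simp only [inl_mem_stage, inl_mem_hseg]; omega
    · simp only [inr_mem_stage, inr_mem_hseg, or_false]
  · intro p' k h1 h2 h3
    simp only [hv, inl_mem_stage]
    omega

/-- The interior of the `i`-th vertical path is continued in rows of length `d`. -/
theorem vsnake (L : IsLadder Q n h r a b) {i s t d : ℕ} (hi : 1 ≤ i) (hin : i < n)
    (hst : s ≤ t) (htr : t < r i) (hd : d ∣ t - s)
    (hp : Port Q (stage h r i (h i) s) (vv h r a b i s) d) :
    Port Q (stage h r i (h i) t) (vv h r a b i t) d := by
  have hr : 1 ≤ r i := by omega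
  refine (Port.snake (St := fun s => stage h r i (h i) s) L.symm hp hst hd
    (fun k hk hk' => L.vertical i k hi hin (by omega)) ?_ ?_).1
  · rintro p' p'' h1 h2 h3 (⟨i', j⟩ | ⟨i', j⟩)
    · simp only [inl_mem_stage, inl_mem_vseg hr (show p' + 1 + (p'' - p') ≤ r i + 1 by omega)]
      omega
    · simp only [inr_mem_stage, inr_mem_vseg]; omega
  · intro p' k h1 h2 h3
    rw [vv, verticalVertex_inner (by omega) (by omega)]
    simp only [inr_mem_stage]
    omega

end IsLadder

/-! ### Rows around the branch vertices -/

namespace IsLadder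

variable {Q : GridName → GridName → Prop} {n : ℕ} {h r a b : ℕ → ℕ}

theorem start (L : IsLadder Q n h r a b) {d : ℕ} (hd : 1 ≤ d) (hdh : d ≤ h 1) :
    Built Q (stage h r 1 d 0) (seg (hv 1) 1 d).reverse := by
  have hn := L.param.1
  refine Built.start_of ?_ ?_ ?_ ?_
  · intro h0
    have := congrArg List.length h0
    simp at this
    omega
  · exact List.nodup_reverse.2 (nodup_hseg _ _ _)
  · exact isChain_reverse_seg L.symm fun k hk hk' => L.horizontal 1 k le_rfl (by omega) hk (by omega)
  · rintro (⟨i', j⟩ | ⟨i', j⟩)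
    · simp only [inl_mem_stage, List.mem_reverse, inl_mem_hseg] ; grind
    · simp only [inr_mem_stage, List.mem_reverse, inr_mem_hseg] ; grind

/-- The row in which the first branch vertex has its neighbour in the previous row, when the
vertical path leads to a later row. -/
theorem minus_mid (L : IsLadder Q n h r a b) {i d : ℕ} (hi : 1 ≤ i) (hin : i < n) (hdr : d ≤ r i)
    (hp : Port Q (stage h r i (h i - a i) 0) (hv i (h i - a i)) d) :
    Port Q (stage h r i (h i) (d - 1)) (vv h r a b i (d - 1)) (d - 1 + a i) := by
  have hr := L.param.2.1 i hi hin
  obtain ⟨ha, hah, -, -⟩ := L.param.2.2.1 i hi hin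
  have hd : 1 ≤ d := by obtain ⟨R, -, h1, -⟩ := hp; exact h1
  have hX := fun i' j => inl_mem_vseg (p := fun i => h i - a i + 1) (q := b) (i' := i') (j := j)
    hr (show 0 + d ≤ r i + 1 by omega)
  -- The row descends the vertical path to the branch vertex, at index `d - 1`, and goes on to the
  -- end of the horizontal path. Its first vertex sees the whole row of length `d - 1 + a i`.
  have hb : Built Q (stage h r i (h i) (d - 1))
      ((seg (vv h r a b i) 0 d).reverse ++ seg (hv i) (h i - a i + 2) (a i - 1)) := by
    refine hp.step (y := hv i (h i - a i + 1)) ?_ ?_ ?_ ?_ ?_ ?_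
    · rw [List.getElem?_append_left (by simp; omega), getElem?_reverse_seg (by omega),
        show 0 + (d - 1 - (d - 1)) = 0 by omega, vv, verticalVertex_zero]
    · exact L.horizontal i _ hi hin.le (by omega) (by omega)
    · refine nodup_append_of (List.nodup_reverse.2 nodup_vseg) (nodup_hseg _ _ _) ?_
      rintro (⟨i', j⟩ | ⟨i', j⟩)
      · simp only [List.mem_reverse, hX, inl_mem_hseg] ; grind
      · simp only [inr_mem_hseg] ; grind
    · refine isChain_append_of (isChain_reverse_seg L.symm fun k hk hk' =>
          L.vertical i k hi hin (by omega)) (isChain_seg fun k hk hk' =>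
          L.horizontal i k hi hin.le (by omega) (by omega)) fun x y hx hy => ?_
      rw [List.length_reverse, length_seg, getElem?_reverse_seg (by omega),
        show 0 + (d - 1 - (d - 1)) = 0 by omega, vv, verticalVertex_zero] at hx
      rw [getElem?_seg (by omega)] at hy
      cases hx
      cases hy
      exact L.horizontal i _ hi hin.le (by omega) (by omega)
    · rintro (⟨i', j⟩ | ⟨i', j⟩)
      · simp only [List.mem_append, List.mem_reverse, inl_mem_stage, hX, inl_mem_hseg] ; grind
      · simp only [List.mem_append, List.mem_reverse, inr_mem_stage, inr_mem_vseg, inr_mem_hseg] ; grind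
    · rintro (⟨i', j⟩ | ⟨i', j⟩)
      · simp only [List.mem_append, List.mem_reverse, inl_mem_stage, hX, inl_mem_hseg] ; grind
      · simp only [List.mem_append, List.mem_reverse, inr_mem_stage, inr_mem_vseg, inr_mem_hseg] ; grind
  refine hb.port (k := 0) ?_ (by simp; omega)
  rw [List.getElem?_append_left (by simp; omega), getElem?_reverse_seg (by omega)]
  congr 2
  omega

/-- The row in which the second branch vertex has its neighbour in the previous row, the horizontal
path being met from its last vertex on. -/
theorem mid_minus (L : IsLadder Q n h r a b) {i s δ m : ℕ} (hi : 1 ≤ i) (hin : i < n)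
    (hs : s < r i) (hδ : δ ∣ r i - 1 - s) (hm : δ + b i = m + 1) (hmh : m ≤ h (i + 1))
    (hp : Port Q (stage h r i (h i) s) (vv h r a b i s) δ) :
    Built Q (stage h r (i + 1) m 0) (seg (hv (i + 1)) 1 m).reverse := by
  obtain ⟨-, -, hb, hbh⟩ := L.param.2.2.1 i hi hin
  have hδ1 : 1 ≤ δ := by obtain ⟨R, -, h1, -⟩ := hp; exact h1
  -- In the reversed initial part of order `m`, the branch vertex has index `m - b i = δ - 1`.
  refine (L.vsnake hi hin (show s ≤ r i - 1 by omega) (by omega) hδ hp).step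
    (y := hv (i + 1) (b i)) ?_ ?_ ?_ ?_ ?_ ?_
  · rw [getElem?_reverse_seg (by omega)]
    congr 2
    omega
  · have := L.vertical i (r i - 1) hi hin (by omega)
    rwa [Nat.sub_add_cancel (by omega), vv, verticalVertex_last (by omega)] at this
  · exact List.nodup_reverse.2 (nodup_hseg _ _ _)
  · exact isChain_reverse_seg L.symm fun k hk hk' =>
      L.horizontal (i + 1) k (by omega) (by omega) hk (by omega)
  · rintro (⟨i', j⟩ | ⟨i', j⟩)
    · simp only [List.mem_reverse, inl_mem_stage, inl_mem_hseg] ; grind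
    · simp only [List.mem_reverse, inr_mem_hseg, false_imp_iff]
  · rintro (⟨i', j⟩ | ⟨i', j⟩) <;> rcases eq_or_ne i' i with rfl | hne
    · simp only [List.mem_reverse, inl_mem_stage, inl_mem_hseg] ; grind
    · simp only [List.mem_reverse, inl_mem_stage, inl_mem_hseg] ; grind
    · simp only [List.mem_reverse, inr_mem_stage, inr_mem_hseg] ; grind
    · simp only [List.mem_reverse, inr_mem_stage, inr_mem_hseg] ; grind

/-- The same with the horizontal path in a single row, met from its first vertex on. -/
theorem mid_minus_single (L : IsLadder Q n h r a b) {i s : ℕ} (hi : 1 ≤ i) (hin : i < n)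
    (hs : s < r i) (hδ : b i ∣ r i - 1 - s)
    (hp : Port Q (stage h r i (h i) s) (vv h r a b i s) (b i)) :
    Built Q (stage h r (i + 1) (h (i + 1)) 0) (seg (hv (i + 1)) 1 (h (i + 1))) := by
  obtain ⟨-, -, hb, hbh⟩ := L.param.2.2.1 i hi hin
  -- Read forwards, the branch vertex has index `b i - 1` whatever the length of the row, so the
  -- port parameter must be `b i`.
  refine (L.vsnake hi hin (show s ≤ r i - 1 by omega) (by omega) hδ hp).step
    (y := hv (i + 1) (b i)) ?_ ?_ ?_ ?_ ?_ ?_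
  · rw [getElem?_seg (by omega)]
    congr 2
    omega
  · have := L.vertical i (r i - 1) hi hin (by omega)
    rwa [Nat.sub_add_cancel (by omega), vv, verticalVertex_last (by omega)] at this
  · exact nodup_hseg _ _ _
  · exact isChain_seg fun k hk hk' =>
      L.horizontal (i + 1) k (by omega) (by omega) hk (by omega)
  · rintro (⟨i', j⟩ | ⟨i', j⟩)
    · simp only [inl_mem_stage, inl_mem_hseg] ; grind
    · simp only [inr_mem_hseg, false_imp_iff]
  · rintro (⟨i', j⟩ | ⟨i', j⟩) <;> rcases eq_or_ne i' i with rfl | hne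
    · simp only [inl_mem_stage, inl_mem_hseg] ; grind
    · simp only [inl_mem_stage, inl_mem_hseg] ; grind
    · simp only [inr_mem_stage, inr_mem_hseg] ; grind
    · simp only [inr_mem_stage, inr_mem_hseg] ; grind

/-- The row in which the second branch vertex has its neighbour in the next row, when the vertical
path comes from an earlier row. -/
theorem mid_plus (L : IsLadder Q n h r a b) {i s δ d : ℕ} (hi : 1 ≤ i) (hin : i < n)
    (hd : 1 ≤ d) (hs : s + d ≤ r i) (hδ : δ ∣ r i - d - s) (hδd : δ + 1 = d + b i)
    (hp : Port Q (stage h r i (h i) s) (vv h r a b i s) δ) :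
    Port Q (stage h r (i + 1) (b i) 0) (hv (i + 1) (b i)) d := by
  obtain ⟨-, -, hb, hbh⟩ := L.param.2.2.1 i hi hin
  have hr := L.param.2.1 i hi hin
  have hX := fun i' j => inl_mem_vseg (p := fun i => h i - a i + 1) (q := b) (i' := i') (j := j)
    hr (show (r i - d + 1) + d ≤ r i + 1 by omega)
  -- The row runs along the horizontal path to the branch vertex and turns back into the vertical
  -- path for its last `d` vertices. The vertex joined to the previous row closes this row of length
  -- `δ`, and the branch vertex is `d - 1` from its end.
  have hb : Built Q (stage h r (i + 1) (b i) 0)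
      (seg (hv (i + 1)) 1 (b i - 1) ++ (seg (vv h r a b i) (r i - d + 1) d).reverse) := by
    refine (L.vsnake hi hin (show s ≤ r i - d by omega) (by omega) hδ hp).step
      (y := vv h r a b i (r i - d + 1)) ?_ ?_ ?_ ?_ ?_ ?_
    · rw [List.getElem?_append_right (by simp; omega), getElem?_reverse_seg (by simp; omega)]
      congr 2
      simp only [length_seg]
      omega
    · exact L.vertical i (r i - d) hi hin (by omega)
    · refine nodup_append_of (nodup_hseg _ _ _) (List.nodup_reverse.2 nodup_vseg) ?_
      rintro (⟨i', j⟩ | ⟨i', j⟩)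
      · simp only [List.mem_reverse, hX, inl_mem_hseg] ; grind
      · simp only [inr_mem_hseg, false_imp_iff]
    · refine isChain_append_of (isChain_seg fun k hk hk' =>
          L.horizontal (i + 1) k (by omega) (by omega) (by omega) (by omega))
          (isChain_reverse_seg L.symm fun k hk hk' =>
          L.vertical i k hi hin (by omega)) fun x y hx hy => ?_
      rw [length_seg, getElem?_seg (by omega)] at hx
      rw [getElem?_reverse_seg (by omega), show r i - d + 1 + (d - 1 - 0) = r i by omega,
        vv, verticalVertex_last hr] at hy
      cases hx
      cases hy
      have := L.horizontal (i + 1) (b i - 1) (by omega) (by omega) (by omega) (by omega)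
      rwa [Nat.sub_add_cancel (by omega),
        show b i - 1 = 1 + (b i - 1 - 1) by omega] at this
    · rintro (⟨i', j⟩ | ⟨i', j⟩)
      · simp only [List.mem_append, List.mem_reverse, inl_mem_stage, hX, inl_mem_hseg] ; grind
      · simp only [List.mem_append, List.mem_reverse, inr_mem_stage, inr_mem_vseg, inr_mem_hseg] ; grind
    · rintro (⟨i', j⟩ | ⟨i', j⟩) <;> rcases eq_or_ne i' i with rfl | hne
      · simp only [List.mem_append, List.mem_reverse, inl_mem_stage, hX, inl_mem_hseg] ; grind
      · simp only [List.mem_append, List.mem_reverse, inl_mem_stage, hX, inl_mem_hseg] ; grind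
      · simp only [List.mem_append, List.mem_reverse, inr_mem_stage, inr_mem_vseg, inr_mem_hseg] ; grind
      · simp only [List.mem_append, List.mem_reverse, inr_mem_stage, inr_mem_vseg, inr_mem_hseg] ; grind
  refine hb.port (k := b i - 1) ?_ (by simp)
  rw [List.getElem?_append_right (by simp), getElem?_reverse_seg (by rw [length_seg]; omega),
    show r i - d + 1 + (d - 1 - (b i - 1 - (seg (hv (i + 1)) 1 (b i - 1)).length)) = r i by
      rw [length_seg]; omega, vv, verticalVertex_last hr]

/-- The row that contains a parallel vertical path. -/
theorem minus_plus_parallel (L : IsLadder Q n h r a b) {i : ℕ} (hi : 1 ≤ i) (hin : i < n)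
    (hp : Port Q (stage h r i (h i - a i) 0) (hv i (h i - a i)) (a i)) :
    Port Q (stage h r (i + 1) (b i) 0) (hv (i + 1) (b i)) (b i) := by
  have hr := L.param.2.1 i hi hin
  obtain ⟨ha, hah, hb, hbh⟩ := L.param.2.2.1 i hi hin
  have hX := fun i' j => inl_mem_vseg (p := fun i => h i - a i + 1) (q := b) (i' := i') (j := j)
    hr (show 0 + (r i + 1) ≤ r i + 1 by omega)
  -- One row: the final part of the upper path backwards, the vertical path, the initial part of the
  -- lower path backwards. The branch vertices are `a i - 1` from the start and `b i - 1` from the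
  -- end.
  have hb : Built Q (stage h r (i + 1) (b i) 0) ((seg (hv i) (h i - a i + 2) (a i - 1)).reverse ++
      (seg (vv h r a b i) 0 (r i + 1) ++ (seg (hv (i + 1)) 1 (b i - 1)).reverse)) := by
    refine hp.step (y := hv i (h i - a i + 1)) ?_ ?_ ?_ ?_ ?_ ?_
    · rw [List.getElem?_append_right (by simp), List.getElem?_append_left (by simp),
        getElem?_seg (by simp), List.length_reverse, length_seg,
        show 0 + (a i - 1 - (a i - 1)) = 0 by omega, vv, verticalVertex_zero]
    · exact L.horizontal i _ hi hin.le (by omega) (by omega)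
    · refine nodup_append_of (List.nodup_reverse.2 (nodup_hseg _ _ _)) (nodup_append_of nodup_vseg
        (List.nodup_reverse.2 (nodup_hseg _ _ _)) ?_) ?_
      · rintro (⟨i', j⟩ | ⟨i', j⟩)
        · simp only [List.mem_reverse, hX, inl_mem_hseg] ; grind
        · simp only [List.mem_reverse, inr_mem_hseg, not_false_iff, implies_true]
      · rintro (⟨i', j⟩ | ⟨i', j⟩)
        · simp only [List.mem_append, List.mem_reverse, hX, inl_mem_hseg] ; grind
        · simp only [List.mem_reverse, inr_mem_hseg, false_imp_iff]
    · refine isChain_append_of (isChain_reverse_seg L.symm fun k hk hk' =>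
          L.horizontal i k hi hin.le (by omega) (by omega))
        (isChain_append_of (isChain_seg fun k hk hk' => L.vertical i k hi hin (by omega))
          (isChain_reverse_seg L.symm fun k hk hk' =>
            L.horizontal (i + 1) k (by omega) (by omega) hk (by omega)) fun x y hx hy => ?_)
          fun x y hx hy => ?_
      · rw [length_seg, getElem?_seg (by omega), show 0 + (r i + 1 - 1) = r i by omega, vv,
          verticalVertex_last hr] at hx
        rw [getElem?_reverse_seg (by omega), show 1 + (b i - 1 - 1 - 0) = b i - 1 by omega] at hy
        cases hx
        cases hy
        have := L.horizontal (i + 1) (b i - 1) (by omega) (by omega) (by omega) (by omega)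
        rw [Nat.sub_add_cancel (by omega)] at this
        exact L.symm _ _ this
      · rw [List.length_reverse, length_seg, getElem?_reverse_seg (by omega),
          show h i - a i + 2 + (a i - 1 - 1 - (a i - 1 - 1)) = h i - a i + 2 by omega] at hx
        rw [List.getElem?_append_left (by simp), getElem?_seg (by omega), vv, zero_add,
          verticalVertex_zero] at hy
        cases hx
        cases hy
        exact L.symm _ _ (L.horizontal i (h i - a i + 1) hi hin.le (by omega) (by omega))
    · rintro (⟨i', j⟩ | ⟨i', j⟩)
      · simp only [List.mem_append, List.mem_reverse, inl_mem_stage, hX, inl_mem_hseg] ; grind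
      · simp only [List.mem_append, List.mem_reverse, inr_mem_stage, inr_mem_vseg, inr_mem_hseg] ; grind
    · rintro (⟨i', j⟩ | ⟨i', j⟩) <;> rcases eq_or_ne i' i with rfl | hne
      · simp only [List.mem_append, List.mem_reverse, inl_mem_stage, hX, inl_mem_hseg] ; grind
      · simp only [List.mem_append, List.mem_reverse, inl_mem_stage, hX, inl_mem_hseg] ; grind
      · simp only [List.mem_append, List.mem_reverse, inr_mem_stage, inr_mem_vseg, inr_mem_hseg] ; grind
      · simp only [List.mem_append, List.mem_reverse, inr_mem_stage, inr_mem_vseg, inr_mem_hseg] ; grind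
  refine hb.port (k := a i - 1 + r i) ?_ (by simp; omega)
  rw [List.getElem?_append_right (by simp), List.getElem?_append_left (by simp),
    getElem?_seg (by simp), List.length_reverse, length_seg,
    show 0 + (a i - 1 + r i - (a i - 1)) = r i by omega, vv, verticalVertex_last hr]

/-- The row that contains a crossed vertical path. -/
theorem minus_plus_crossed (L : IsLadder Q n h r a b) {i : ℕ} (hi : 1 ≤ i) (hin : i < n)
    (hp : Port Q (stage h r i (h i - a i) 0) (hv i (h i - a i)) (b i + r i)) :
    Port Q (stage h r (i + 1) (b i) 0) (hv (i + 1) (b i)) (a i + r i) := by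
  have hr := L.param.2.1 i hi hin
  obtain ⟨ha, hah, hb, hbh⟩ := L.param.2.2.1 i hi hin
  have hX := fun i' j => inl_mem_vseg (p := fun i => h i - a i + 1) (q := b) (i' := i') (j := j)
    hr (show 0 + (r i + 1) ≤ r i + 1 by omega)
  -- The parallel row traversed in the opposite direction: the first branch vertex is now `b i + r i
  -- - 1` from the start, the second `a i + r i - 1` from the end.
  have hb : Built Q (stage h r (i + 1) (b i) 0) (seg (hv (i + 1)) 1 (b i - 1) ++
      ((seg (vv h r a b i) 0 (r i + 1)).reverse ++ seg (hv i) (h i - a i + 2) (a i - 1))) := by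
    refine hp.step (y := hv i (h i - a i + 1)) ?_ ?_ ?_ ?_ ?_ ?_
    · rw [List.getElem?_append_right (by simp; omega), List.getElem?_append_left (by simp; omega),
        getElem?_reverse_seg (by simp; omega), length_seg,
        show 0 + (r i + 1 - 1 - (b i + r i - 1 - (b i - 1))) = 0 by omega, vv, verticalVertex_zero]
    · exact L.horizontal i _ hi hin.le (by omega) (by omega)
    · refine nodup_append_of (nodup_hseg _ _ _) (nodup_append_of (List.nodup_reverse.2 nodup_vseg)
        (nodup_hseg _ _ _) ?_) ?_
      · rintro (⟨i', j⟩ | ⟨i', j⟩)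
        · simp only [List.mem_reverse, hX, inl_mem_hseg] ; grind
        · simp only [inr_mem_hseg, not_false_iff, implies_true]
      · rintro (⟨i', j⟩ | ⟨i', j⟩)
        · simp only [List.mem_append, List.mem_reverse, hX, inl_mem_hseg] ; grind
        · simp only [inr_mem_hseg, false_imp_iff]
    · refine isChain_append_of (isChain_seg fun k hk hk' =>
          L.horizontal (i + 1) k (by omega) (by omega) hk (by omega))
        (isChain_append_of (isChain_reverse_seg L.symm fun k hk hk' =>
            L.vertical i k hi hin (by omega))
          (isChain_seg fun k hk hk' =>
            L.horizontal i k hi hin.le (by omega) (by omega)) fun x y hx hy => ?_)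
          fun x y hx hy => ?_
      · rw [List.length_reverse, length_seg, getElem?_reverse_seg (by omega), Nat.sub_self, zero_add,
          vv, verticalVertex_zero] at hx
        rw [getElem?_seg (by omega)] at hy
        cases hx
        cases hy
        exact L.horizontal i (h i - a i + 1) hi hin.le (by omega) (by omega)
      · rw [length_seg, getElem?_seg (by omega),
          show 1 + (b i - 1 - 1) = b i - 1 by omega] at hx
        rw [List.getElem?_append_left (by simp), getElem?_reverse_seg (by omega), vv,
          show 0 + (r i + 1 - 1 - 0) = r i by omega, verticalVertex_last hr] at hy
        cases hx
        cases hy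
        have := L.horizontal (i + 1) (b i - 1) (by omega) (by omega) (by omega) (by omega)
        rwa [Nat.sub_add_cancel (by omega)] at this
    · rintro (⟨i', j⟩ | ⟨i', j⟩)
      · simp only [List.mem_append, List.mem_reverse, inl_mem_stage, hX, inl_mem_hseg] ; grind
      · simp only [List.mem_append, List.mem_reverse, inr_mem_stage, inr_mem_vseg, inr_mem_hseg] ; grind
    · rintro (⟨i', j⟩ | ⟨i', j⟩) <;> rcases eq_or_ne i' i with rfl | hne
      · simp only [List.mem_append, List.mem_reverse, inl_mem_stage, hX, inl_mem_hseg] ; grind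
      · simp only [List.mem_append, List.mem_reverse, inl_mem_stage, hX, inl_mem_hseg] ; grind
      · simp only [List.mem_append, List.mem_reverse, inr_mem_stage, inr_mem_vseg, inr_mem_hseg] ; grind
      · simp only [List.mem_append, List.mem_reverse, inr_mem_stage, inr_mem_vseg, inr_mem_hseg] ; grind
  refine hb.port (k := b i - 1) ?_ (by simp; omega)
  rw [List.getElem?_append_right (by simp), List.getElem?_append_left (by simp),
    getElem?_reverse_seg (by simp), length_seg,
    show 0 + (r i + 1 - 1 - (b i - 1 - (b i - 1))) = r i by omega, vv, verticalVertex_last hr]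

end IsLadder

/-! ### Gluing -/

/-- The first branch vertex of the vertical path has its neighbour in the next row. -/
def StartsPlus (α : VerticalPath) : Prop := α = .beta ∨ α = .sigmaPlus

/-- The second branch vertex of the vertical path has its neighbour in the previous row. -/
def EndsMinus (α : VerticalPath) : Prop := α = .beta ∨ α = .sigmaMinus

/-- The relations between the divisors along a vertical path of length `r` that cuts off parts of
orders `x` and `y`. -/
def JointCond (r d d' δ x y : ℕ) : VerticalPath → Prop
  | .pi => d = x ∧ d' = y
  | .gamma => d = y + r ∧ d' = x + r
  | .beta => δ ∣ r - 1
  | .mu => δ + 1 = d + x ∧ δ + 1 = d' + y ∧ d + d' ≤ r + 1 ∧ δ ∣ r + 1 - (d + d')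
  | .sigmaMinus => δ + 1 = d + x ∧ d ≤ r ∧ δ ∣ r - d
  | .sigmaPlus => δ + 1 = d' + y ∧ d' ≤ r ∧ δ ∣ r - d'

/-- Divisors for all the horizontal and vertical paths of a tree in `𝓗_n`. -/
structure Divisors (n : ℕ) (h r a b : ℕ → ℕ) (α : ℕ → VerticalPath) (d δ : ℕ → ℕ) : Prop where
  d_pos : ∀ i, 1 ≤ i → i ≤ n → 1 ≤ d i
  δ_pos : ∀ i, 1 ≤ i → i < n → 1 ≤ δ i
  joint : ∀ i, 1 ≤ i → i < n → JointCond (r i) (d i) (d (i + 1)) (δ i) (a i) (b i) (α i)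
  first_minus : ¬ StartsPlus (α 1) → d 1 ∣ h 1 - a 1
  first_plus : StartsPlus (α 1) → d 1 ∣ h 1 ∧ d 1 + 1 = δ 1 + a 1
  last_plus : ¬ EndsMinus (α (n - 1)) → d n ∣ h n - b (n - 1)
  last_minus : EndsMinus (α (n - 1)) → d n ∣ h n ∧ d n + 1 = δ (n - 1) + b (n - 1)
  plus_minus : ∀ i, 1 ≤ i → i + 1 < n → ¬ EndsMinus (α i) → ¬ StartsPlus (α (i + 1)) →
    d (i + 1) ∣ h (i + 1) - a (i + 1) - b i
  plus_plus : ∀ i, 1 ≤ i → i + 1 < n → ¬ EndsMinus (α i) → StartsPlus (α (i + 1)) →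
    d (i + 1) ∣ h (i + 1) - b i ∧ d (i + 1) + 1 = δ (i + 1) + a (i + 1)
  minus_minus : ∀ i, 1 ≤ i → i + 1 < n → EndsMinus (α i) → ¬ StartsPlus (α (i + 1)) →
    d (i + 1) ∣ h (i + 1) - a (i + 1) ∧ d (i + 1) + 1 = δ i + b i
  minus_plus : ∀ i, 1 ≤ i → i + 1 < n → EndsMinus (α i) → StartsPlus (α (i + 1)) →
    (d (i + 1) ∣ h (i + 1) ∧ d (i + 1) + 1 = δ i + b i ∧
      d (i + 1) + 1 = δ (i + 1) + a (i + 1)) ∨ (δ i = b i ∧ δ (i + 1) = a (i + 1))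

/-! ### Induction along the ladder -/

namespace IsLadder

variable {Q : GridName → GridName → Prop} {n : ℕ} {h r a b : ℕ → ℕ}

theorem port_of_rows {i d : ℕ} (hd : 1 ≤ d)
    (hb : Built Q (stage h r i d 0) (seg (hv i) 1 d).reverse) :
    Port Q (stage h r i d 0) (hv i d) d := by
  refine hb.port (k := 0) ?_ (by simp)
  rw [getElem?_reverse_seg hd]
  congr 2
  omega

/-- The last row is the final part of order `d`, reversed: the branch vertex has index `a i - 1`,
and `d - (a i - 1) = δ` vertices remain, itself included. -/
theorem port_branch {i d δ : ℕ} (hδ : 1 ≤ δ) (hdδ : d + 1 = δ + a i) (ha : 1 ≤ a i) (hd : d ≤ h i)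
    (hb : Built Q (stage h r i (h i) 0) (seg (hv i) (h i - d + 1) d).reverse) :
    Port Q (stage h r i (h i) 0) (hv i (h i - a i + 1)) δ := by
  refine hb.port (k := a i - 1) ?_ (by simp; omega)
  rw [getElem?_reverse_seg (by omega)]
  congr 2
  omega

theorem rows_of_port (L : IsLadder Q n h r a b) {i c d : ℕ} (hi : 1 ≤ i) (hin : i ≤ n)
    (hc : 1 ≤ c) (hch : c < h i) (hd : d ∣ h i - c)
    (hp : Port Q (stage h r i c 0) (hv i c) d) :
    d ≤ h i ∧ Built Q (stage h r i (h i) 0) (seg (hv i) (h i - d + 1) d).reverse := by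
  have := (L.hsnake hi hin hc hch.le le_rfl hd hp).2 hch
  exact ⟨by omega, this.2⟩

theorem rows_of_rows (L : IsLadder Q n h r a b) {i d : ℕ} (hi : 1 ≤ i) (hin : i ≤ n)
    (hd : 1 ≤ d) (hdh : d ≤ h i) (hdvd : d ∣ h i)
    (hb : Built Q (stage h r i d 0) (seg (hv i) 1 d).reverse) :
    Built Q (stage h r i (h i) 0) (seg (hv i) (h i - d + 1) d).reverse := by
  rcases hdh.eq_or_lt with heq | hlt
  · rw [← heq, Nat.sub_self]
    exact hb
  · exact (L.rows_of_port hi hin hd hlt (Nat.dvd_sub hdvd dvd_rfl) (port_of_rows hd hb)).2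

variable {α : ℕ → VerticalPath} {d δ : ℕ → ℕ}

/-- The part of the ladder before the `i`-th vertical path is covered by rows so that this vertical
path can be attached. -/
def Ready (Q : GridName → GridName → Prop) (h r a : ℕ → ℕ) (α : ℕ → VerticalPath) (d δ : ℕ → ℕ)
    (i : ℕ) : Prop :=
  (¬ StartsPlus (α i) → Port Q (stage h r i (h i - a i) 0) (hv i (h i - a i)) (d i)) ∧
  (StartsPlus (α i) → Port Q (stage h r i (h i) 0) (hv i (h i - a i + 1)) (δ i))

theorem ready_first (L : IsLadder Q n h r a b) (D : Divisors n h r a b α d δ) :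
    Ready Q h r a α d δ 1 := by
  have hn := L.param.1
  obtain ⟨ha, hah, -, -⟩ := L.param.2.2.1 1 le_rfl (by omega)
  have hd := D.d_pos 1 le_rfl (by omega)
  constructor
  · intro hα
    have hdvd := D.first_minus hα
    have hle := Nat.le_of_dvd (by omega) hdvd
    exact (L.hsnake le_rfl (by omega) hd hle (by omega) (Nat.dvd_sub hdvd dvd_rfl)
      (port_of_rows hd (L.start hd (by omega)))).1
  · intro hα
    obtain ⟨hdvd, hδ⟩ := D.first_plus hα
    have hle := Nat.le_of_dvd (by omega) hdvd
    exact port_branch (D.δ_pos 1 le_rfl (by omega)) hδ ha.le hle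
      (L.rows_of_rows le_rfl (by omega) hd hle hdvd (L.start hd hle))

theorem Ready.mid_of_plus {i : ℕ} (R : Ready Q h r a α d δ i) (hα : StartsPlus (α i)) :
    Port Q (stage h r i (h i) 0) (vv h r a b i 0) (δ i) := by
  rw [vv, verticalVertex_zero]
  exact R.2 hα

/-- `s` counts the interior vertices of the vertical path already placed: none for `β`, and `d i -
1` for `σ⁻`, where they share the row of the first branch vertex. -/
theorem ready_mid (L : IsLadder Q n h r a b) (D : Divisors n h r a b α d δ) {i : ℕ} (hi : 1 ≤ i)
    (hin : i < n) (R : Ready Q h r a α d δ i) (hα : EndsMinus (α i)) :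
    ∃ s, s < r i ∧ δ i ∣ r i - 1 - s ∧ Port Q (stage h r i (h i) s) (vv h r a b i s) (δ i) := by
  have hr := L.param.2.1 i hi hin
  have hJ := D.joint i hi hin
  rcases hα with hα | hα <;> rw [hα] at hJ <;> simp only [JointCond] at hJ
  · exact ⟨0, hr, hJ, R.mid_of_plus (Or.inl hα)⟩
  · obtain ⟨h1, h2, h3⟩ := hJ
    have hd := D.d_pos i hi hin.le
    have := L.minus_mid hi hin h2 (R.1 (by simp [StartsPlus, hα]))
    rw [show d i - 1 + a i = δ i by omega] at this
    exact ⟨d i - 1, by omega, by rwa [show r i - 1 - (d i - 1) = r i - d i by omega], this⟩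

/-- For `π` and `γ` a single row contains the whole vertical path. For `μ` both branch rows borrow
interior vertices and the rest is folded in rows of length `δ i`; for `σ⁺` only the second one
borrows. -/
theorem ready_plus (L : IsLadder Q n h r a b) (D : Divisors n h r a b α d δ) {i : ℕ} (hi : 1 ≤ i)
    (hin : i < n) (R : Ready Q h r a α d δ i) (hα : ¬ EndsMinus (α i)) :
    Port Q (stage h r (i + 1) (b i) 0) (hv (i + 1) (b i)) (d (i + 1)) := by
  have hJ := D.joint i hi hin
  have hd := D.d_pos i hi hin.le
  have hd' := D.d_pos (i + 1) (by omega) hin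
  have hR := R.1
  cases hαi : α i <;> rw [hαi] at hJ hα hR <;> simp only [JointCond] at hJ
  · rw [hJ.1] at hR
    rw [hJ.2]
    exact L.minus_plus_parallel hi hin (hR (by simp [StartsPlus]))
  · rw [hJ.1] at hR
    rw [hJ.2]
    exact L.minus_plus_crossed hi hin (hR (by simp [StartsPlus]))
  · exact absurd (Or.inl rfl) hα
  · obtain ⟨h1, h2, h3, h4⟩ := hJ
    have := L.minus_mid hi hin (by omega) (hR (by simp [StartsPlus]))
    rw [show d i - 1 + a i = δ i by omega] at this
    exact L.mid_plus hi hin hd' (by omega)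
      (by rwa [show r i - d (i + 1) - (d i - 1) = r i + 1 - (d i + d (i + 1)) by omega]) h2 this
  · obtain ⟨h1, h2, h3⟩ := hJ
    exact L.mid_plus hi hin hd' (by omega) h3 h1 (R.mid_of_plus (Or.inr hαi))
  · exact absurd (Or.inr rfl) hα

/-- An inner horizontal path is entered at its branch vertex (`plus`) or by a row starting the path
(`minus`), and left either just before its second branch vertex or from that vertex once the path is
complete. The four combinations use the last four fields of `Divisors`. -/
theorem ready_succ (L : IsLadder Q n h r a b) (D : Divisors n h r a b α d δ) {i : ℕ} (hi : 1 ≤ i)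
    (hin : i + 1 < n) (R : Ready Q h r a α d δ i) : Ready Q h r a α d δ (i + 1) := by
  have hd := D.d_pos (i + 1) (by omega) hin.le
  have hδ := D.δ_pos (i + 1) (by omega) hin
  obtain ⟨ha, hah, -, -⟩ := L.param.2.2.1 (i + 1) (by omega) hin
  obtain ⟨-, -, hb, hbh⟩ := L.param.2.2.1 i hi (by omega)
  have hab : b i + a (i + 1) ≤ h (i + 1) := L.param.2.2.2 (i + 1) (by omega) hin
  by_cases hE : EndsMinus (α i)
  · obtain ⟨s, hs, hδs, hp⟩ := L.ready_mid D hi (by omega) R hE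
    constructor
    · intro hα
      obtain ⟨hdvd, hdδ⟩ := D.minus_minus i hi hin hE hα
      have hle := Nat.le_of_dvd (by omega) hdvd
      have hB := L.mid_minus hi (by omega) hs hδs hdδ.symm (by omega) hp
      exact (L.hsnake (by omega) hin.le hd hle (by omega) (Nat.dvd_sub hdvd dvd_rfl)
        (port_of_rows hd hB)).1
    · intro hα
      -- Either the path is folded in rows of length `d (i + 1)`, or it is one forward row
      -- containing both branch vertices.
      rcases D.minus_plus i hi hin hE hα with ⟨hdvd, hdδ, hdδ'⟩ | ⟨hδb, hδa⟩
      · have hle := Nat.le_of_dvd (by omega) hdvd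
        have hB := L.mid_minus hi (by omega) hs hδs hdδ.symm hle hp
        exact port_branch hδ hdδ' ha.le hle (L.rows_of_rows (by omega) hin.le hd hle hdvd hB)
      · rw [hδb] at hp hδs
        have hB := L.mid_minus_single hi (by omega) hs hδs hp
        rw [hδa]
        refine hB.port (k := h (i + 1) - a (i + 1)) ?_ (by simp; omega)
        rw [getElem?_seg (by omega)]
        congr 2
        omega
  · have hp := L.ready_plus D hi (by omega) R hE
    constructor
    · intro hα
      have hdvd := D.plus_minus i hi hin hE hα
      exact (L.hsnake (by omega) hin.le hb.le (by omega) (by omega) hdvd hp).1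
    · intro hα
      obtain ⟨hdvd, hdδ⟩ := D.plus_plus i hi hin hE hα
      obtain ⟨hle, hB⟩ := L.rows_of_port (by omega) hin.le hb.le hbh hdvd hp
      exact port_branch hδ hdδ ha.le hle hB

theorem exists_built (L : IsLadder Q n h r a b) (D : Divisors n h r a b α d δ) :
    ∃ R, Built Q (stage h r n (h n) 0) R := by
  have hn := L.param.1
  have hready : ∀ i, 1 ≤ i → i < n → Ready Q h r a α d δ i := by
    intro i hi
    induction i, hi using Nat.le_induction with
    | base => exact fun _ => L.ready_first D
    | succ i hi ih => exact fun hin => L.ready_succ D hi hin (ih (by omega))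
  obtain ⟨m, rfl⟩ : ∃ m, n = m + 1 := ⟨n - 1, by omega⟩
  have R := hready m (by omega) (by omega)
  obtain ⟨-, -, hb, hbh⟩ := L.param.2.2.1 m (by omega) (by omega)
  have hd := D.d_pos (m + 1) (by omega) le_rfl
  by_cases hE : EndsMinus (α m)
  · obtain ⟨s, hs, hδs, hp⟩ := L.ready_mid D (by omega) (by omega) R hE
    obtain ⟨hdvd, hdδ⟩ := D.last_minus hE
    have hle := Nat.le_of_dvd (by omega) hdvd
    have hB := L.mid_minus (by omega) (by omega) hs hδs hdδ.symm hle hp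
    exact ⟨_, L.rows_of_rows (by omega) le_rfl hd hle hdvd hB⟩
  · have hp := L.ready_plus D (by omega) (by omega) R hE
    exact ⟨_, (L.rows_of_port (by omega) le_rfl hb.le hbh (D.last_plus hE) hp).2⟩

end IsLadder

/-! ### The divisors of the trees of type `H` -/

/-- `x` occurs only if the first branch vertex is attached to the previous row, `y` only if the
second is attached to the next one. -/
theorem JointCond.congr {r d d' δ x y x' y' : ℕ} {α : VerticalPath}
    (H : JointCond r d d' δ x y α) (hx : ¬ StartsPlus α → x = x') (hy : ¬ EndsMinus α → y = y') :
    JointCond r d d' δ x' y' α := by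
  cases α <;> simp [StartsPlus, EndsMinus] at hx hy <;> subst_vars <;> exact H

/-- The alternatives in the definition of divisors all choose an end from which a branch vertex is
counted; `x` and `y` record this choice. For `π` and `γ` there is none. -/
theorem exists_joint_of_areDivisors {s t r a b d d' δ : ℕ} {α : VerticalPath}
    (hp : IsTypeHParam s t r a b) (H : AreDivisors s t r a b d d' δ α) :
    (1 ≤ d ∧ 1 ≤ d' ∧ 1 ≤ δ) ∧ ∃ x y, (x = a ∨ x = s - a + 1) ∧ (y = b ∨ y = t - b + 1) ∧
      (α = .pi ∨ α = .gamma → x = a ∧ y = b) ∧ JointCond r d d' δ x y α ∧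
      (¬ StartsPlus α → d ∣ s - x) ∧ (StartsPlus α → d ∣ s ∧ d + 1 = δ + x) ∧
      (¬ EndsMinus α → d' ∣ t - y) ∧ (EndsMinus α → d' ∣ t ∧ d' + 1 = δ + y) := by
  obtain ⟨ha, has, hb, hbt, hr⟩ := hp
  have pos : ∀ {c m : ℕ}, c ∣ m → 0 < m → 1 ≤ c := fun h hm => Nat.pos_of_dvd_of_pos h hm
  cases α <;> simp only [AreDivisors] at H
  · obtain ⟨rfl, rfl, h1, h2, -, -, rfl⟩ := H
    refine ⟨by omega, d, d', by simp, by simp, by simp, ⟨rfl, rfl⟩, fun _ => Nat.dvd_sub h1 dvd_rfl,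
      by simp [StartsPlus], fun _ => Nat.dvd_sub h2 dvd_rfl, by simp [EndsMinus]⟩
  · obtain ⟨rfl, rfl, h1, h2, -, -, rfl⟩ := H
    refine ⟨by omega, a, b, by simp, by simp, by simp, ⟨rfl, rfl⟩, fun _ => h1,
      by simp [StartsPlus], fun _ => h2, by simp [EndsMinus]⟩
  · obtain ⟨h1, h2⟩ := H
    have h3 : 1 ≤ δ ∧ d ∣ s ∧ d' ∣ t := by
      rcases h2 with h2 | ⟨rfl, rfl, h2⟩ | ⟨rfl, h2⟩ | ⟨h3, h4, rfl, h2⟩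
      · exact ⟨by omega, h2.1, h2.2.1⟩
      · exact ⟨by omega, dvd_rfl, dvd_rfl⟩
      · exact ⟨by omega, dvd_rfl, h2.1⟩
      · exact ⟨by omega, h3, dvd_rfl⟩
    -- Where a minimum occurs it selects the nearer end. Where `d = s`, `δ` is one of the two
    -- positions and `x` the other, as they sum to `s + 1`.
    have h4 : ∃ x, (x = a ∨ x = s - a + 1) ∧ d + 1 = δ + x := by
      by_cases h : d + 1 = δ + a
      · exact ⟨a, Or.inl rfl, h⟩
      · exact ⟨s - a + 1, Or.inr rfl, by omega⟩
    have h5 : ∃ y, (y = b ∨ y = t - b + 1) ∧ d' + 1 = δ + y := by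
      by_cases h : d' + 1 = δ + b
      · exact ⟨b, Or.inl rfl, h⟩
      · exact ⟨t - b + 1, Or.inr rfl, by omega⟩
    obtain ⟨x, hx, hdx⟩ := h4
    obtain ⟨y, hy, hdy⟩ := h5
    exact ⟨⟨pos h3.2.1 (by omega), pos h3.2.2 (by omega), h3.1⟩, x, y, hx, hy, by simp, h1,
      by simp [StartsPlus], fun _ => ⟨h3.2.1, hdx⟩, by simp [EndsMinus], fun _ => ⟨h3.2.2, hdy⟩⟩
  · obtain ⟨x, y, hx, hy, h1, h2, h3, h4, h5, h6⟩ := H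
    have := pos h1 (by omega)
    have := pos h2 (by omega)
    exact ⟨by omega, x, y, hx, hy, by simp, ⟨h3, h4, h5, h6⟩, fun _ => h1, by simp [StartsPlus],
      fun _ => h2, by simp [EndsMinus]⟩
  · obtain ⟨y, hy, h1, h2, h3, h4, h5, h6⟩ := H
    have := pos h1 (by omega)
    have := pos h2 (by omega)
    obtain ⟨x, hx, hdx⟩ : ∃ x, (x = a ∨ x = s - a + 1) ∧ d + 1 = δ + x := by
      rcases h6 with h6 | h6
      · exact ⟨a, Or.inl rfl, by omega⟩
      · exact ⟨s - a + 1, Or.inr rfl, by omega⟩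
    exact ⟨by omega, x, y, hx, hy, by simp, ⟨h3, h4, h5⟩, by simp [StartsPlus], fun _ => ⟨h1, hdx⟩,
      fun _ => h2, by simp [EndsMinus]⟩
  · obtain ⟨x, hx, h1, h2, h3, h4, h5, h6⟩ := H
    have := pos h1 (by omega)
    have := pos h2 (by omega)
    obtain ⟨y, hy, hdy⟩ : ∃ y, (y = b ∨ y = t - b + 1) ∧ d' + 1 = δ + y := by
      rcases h6 with h6 | h6
      · exact ⟨b, Or.inl rfl, by omega⟩
      · exact ⟨t - b + 1, Or.inr rfl, by omega⟩
    exact ⟨by omega, x, y, hx, hy, by simp, ⟨h3, h4, h5⟩, fun _ => h1, by simp [StartsPlus],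
      by simp [EndsMinus], fun _ => ⟨h2, hdy⟩⟩

/-- The positions of the branch vertices on the outermost horizontal paths can be counted from such
ends that the divisors of the trees of type `H` fit together. -/
theorem exists_divisors {n : ℕ} {h r a b : ℕ → ℕ} (hP : IsHnParam n h r a b)
    {α : ℕ → VerticalPath} {s t d δ : ℕ → ℕ} (hs1 : s 1 = h 1) (htn : t n = h n)
    (hTi : ∀ i, 1 ≤ i → i ≤ n - 1 → ∃ a' b',
      (a' = a i ∨ (i = 1 ∧ a' = h 1 - a 1 + 1)) ∧
      (b' = b i ∨ (i = n - 1 ∧ b' = h n - b (n - 1) + 1)) ∧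
      IsPathLikeTypeH (s i) (t (i + 1)) (r i) a' b' (α i) (d i) (d (i + 1)) (δ i))
    (hst : ∀ i, 2 ≤ i → i ≤ n - 1 → OrderRule (h i) (a i) (s i) (t i) (d i) (α i))
    (hleft : ∀ i, 2 ≤ i → i ≤ n - 1 → GlueLeft h r a b d δ i (α (i - 1)))
    (hright : ∀ i, 2 ≤ i → i ≤ n - 1 → GlueRight n h r a b d δ i (α i))
    (hextra : ∀ i, 2 ≤ i → i ≤ n - 1 → GlueExtra h a b d δ α i) :
    ∃ x y, (x = a 1 ∨ x = h 1 - a 1 + 1) ∧ (y = b (n - 1) ∨ y = h n - b (n - 1) + 1) ∧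
      Divisors n h r (Function.update a 1 x) (Function.update b (n - 1) y) α d δ := by
  obtain ⟨hn, hr, hab, hdisj⟩ := hP
  -- The end is chosen separately for each `T_i`. On inner paths the glue conditions force the true
  -- position wherever `JointCond` depends on it.
  have key : ∀ i, ∃ x y, 1 ≤ i → i < n → (1 ≤ d i ∧ 1 ≤ d (i + 1) ∧ 1 ≤ δ i) ∧
      1 < t (i + 1) ∧
      (i = 1 → x = a 1 ∨ x = h 1 - a 1 + 1) ∧
      (i = n - 1 → y = b (n - 1) ∨ y = h n - b (n - 1) + 1) ∧
      (i ≠ n - 1 → b i < t (i + 1)) ∧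
      (i ≠ 1 → ¬ StartsPlus (α i) → x = a i) ∧ (i ≠ n - 1 → ¬ EndsMinus (α i) → y = b i) ∧
      JointCond (r i) (d i) (d (i + 1)) (δ i) x y (α i) ∧
      (¬ StartsPlus (α i) → d i ∣ s i - x) ∧ (StartsPlus (α i) → d i ∣ s i ∧ d i + 1 = δ i + x) ∧
      (¬ EndsMinus (α i) → d (i + 1) ∣ t (i + 1) - y) ∧
      (EndsMinus (α i) → d (i + 1) ∣ t (i + 1) ∧ d (i + 1) + 1 = δ i + y) := by
    intro i
    by_cases hi : 1 ≤ i ∧ i < n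
    swap
    · exact ⟨0, 0, fun h1 h2 => absurd ⟨h1, h2⟩ hi⟩
    obtain ⟨hi1, hin⟩ := hi
    obtain ⟨a', b', ha', hb', hH, -, hD⟩ := hTi i hi1 (by omega)
    obtain ⟨hpos, x, y, hx, hy, hxy, hJ, h1, h2, h3, h4⟩ := exists_joint_of_areDivisors hH hD
    obtain ⟨g1, g2, g3, g4, -⟩ := hH
    obtain ⟨k1, k2, k3, k4⟩ := hab i hi1 hin
    refine ⟨x, y, fun _ _ => ⟨hpos, by omega, ?_, ?_, ?_, ?_, ?_, hJ, h1, h2, h3, h4⟩⟩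
    · rintro rfl
      rw [hs1] at hx g2
      omega
    · intro hi
      obtain rfl : n = i + 1 := by omega
      rw [htn] at hy g4
      simp only [Nat.add_sub_cancel] at hb' ⊢
      omega
    · intro hi
      omega
    · intro hi hα
      have hG := hright i (by omega) (by omega)
      -- For `μ` and `σ⁻`, both `d i + a i` and `d i + x` equal `δ i + 1`.
      cases hαi : α i <;> simp [hαi, StartsPlus] at hα hxy <;>
        simp only [hαi, GlueRight, JointCond] at hG hJ <;> omega
    · intro hi hα
      have hG := hleft (i + 1) (by omega) (by omega)
      rw [Nat.add_sub_cancel] at hG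
      cases hαi : α i <;> simp [hαi, EndsMinus] at hα hxy <;>
        simp only [hαi, GlueLeft, JointCond, Nat.add_sub_cancel] at hG hJ <;> omega
  choose X Y hXY using key
  have hua : ∀ i, i ≠ 1 → Function.update a 1 (X 1) i = a i := fun i hi => Function.update_of_ne hi _ _
  have hub : ∀ i, i ≠ n - 1 → Function.update b (n - 1) (Y (n - 1)) i = b i :=
    fun i hi => Function.update_of_ne hi _ _
  have first := hXY 1 le_rfl (by omega)
  have last := hXY (n - 1) (by omega) (by omega)
  rw [show n - 1 + 1 = n by omega, htn] at last
  rw [hs1] at first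
  refine ⟨X 1, Y (n - 1), first.2.2.1 rfl, last.2.2.2.1 rfl, ?_, ?_, ?_, ?_, ?_, ?_, ?_, ?_, ?_, ?_, ?_⟩
  · intro i hi hin
    rcases hin.eq_or_lt with rfl | hlt
    · exact last.1.2.1
    · exact (hXY i hi hlt).1.1
  · exact fun i hi hin => (hXY i hi hin).1.2.2
  · intro i hi hin
    obtain ⟨-, -, -, -, -, hx, hy, hJ, -⟩ := hXY i hi hin
    refine hJ.congr (fun hα => ?_) (fun hα => ?_)
    · by_cases h1 : i = 1
      · subst h1; rw [Function.update_self]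
      · rw [hua i h1, hx h1 hα]
    · by_cases h1 : i = n - 1
      · subst h1; rw [Function.update_self]
      · rw [hub i h1, hy h1 hα]
  · rw [Function.update_self]
    exact first.2.2.2.2.2.2.2.2.1
  · rw [Function.update_self]
    exact first.2.2.2.2.2.2.2.2.2.1
  · rw [Function.update_self]
    exact last.2.2.2.2.2.2.2.2.2.2.1
  · rw [Function.update_self]
    exact last.2.2.2.2.2.2.2.2.2.2.2
  all_goals
    intro i hi hin hE hS
    obtain ⟨hpos, ht, -, -, hbt, -, hy, -, -, -, h3, h4⟩ := hXY i hi (by omega)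
    have hO := hst (i + 1) (by omega) (by omega)
    have hG := hright (i + 1) (by omega) (by omega)
    have hL := hleft (i + 1) (by omega) (by omega)
    have hX := hextra (i + 1) (by omega) (by omega)
    have hb := hbt (by omega)
    obtain ⟨k1, k2, -, -⟩ := hab (i + 1) (by omega) hin
    obtain ⟨-, -, k3, k4⟩ := hab i hi (by omega)
    rw [hua (i + 1) (by omega), hub i (by omega)]
    simp only [Nat.add_sub_cancel] at hL hX
    unfold StartsPlus at hS
    unfold GlueExtra at hX
    simp only [Nat.add_sub_cancel] at hX
  · have hd := h3 hE
    rw [hy (by omega) hE] at hd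
    rcases hO with ⟨hO1, ⟨-, hO2⟩ | ⟨-, hO2⟩⟩ | ⟨hO1, -, -⟩
    -- For `α (i + 1) = π` the divisor is `a (i + 1)` itself, so cutting off that part preserves
    -- divisibility.
    · rw [hO2] at hG
      simp only [GlueRight] at hG
      rw [hO1] at hd
      rw [← hG, Nat.sub_right_comm]
      exact Nat.dvd_sub hd dvd_rfl
    · exact absurd hO2 hS
    · rwa [hO1] at hd
  · have hd := h3 hE
    rw [hy (by omega) hE] at hd
    have ht' : t (i + 1) = h (i + 1) := by
      rcases hO with ⟨hO1, -⟩ | ⟨-, -, hO2⟩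
      · exact hO1
      · rcases hS with hS | hS <;> simp [hS] at hO2
    rw [ht'] at hd
    refine ⟨hd, (hX hS).1 (Or.inl ?_)⟩
    revert hE
    cases α i <;> simp [EndsMinus]
  · obtain ⟨hd, -⟩ := h4 hE
    have hL' : (δ i ≠ b i → d (i + 1) + 1 = δ i + b i) ∧ (δ i = b i → d (i + 1) = h (i + 1)) := by
      rcases hE with hE | hE <;> simpa [hE, GlueLeft] using hL
    -- Being smaller than `h (i + 1)`, the divisor excludes the case `δ i = b i` of the glue
    -- condition.
    have hlt : d (i + 1) < h (i + 1) ∧ d (i + 1) ∣ h (i + 1) - a (i + 1) := by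
      rcases hO with ⟨hO1, ⟨-, hO2⟩ | ⟨-, hO2⟩⟩ | ⟨hO1, -, -⟩
      · rw [hO2] at hG
        simp only [GlueRight] at hG
        rw [hO1] at hd
        exact ⟨by omega, by rw [← hG]; exact Nat.dvd_sub hd dvd_rfl⟩
      · exact absurd hO2 hS
      · rw [hO1] at hd
        have := Nat.le_of_dvd (by omega) hd
        exact ⟨by omega, hd⟩
    exact ⟨hlt.2, hL'.1 fun hc => by have := hL'.2 hc; omega⟩
  · obtain ⟨hd, -⟩ := h4 hE
    have hL' : (δ i ≠ b i → d (i + 1) + 1 = δ i + b i) ∧ (δ i = b i → d (i + 1) = h (i + 1)) := by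
      rcases hE with hE | hE <;> simpa [hE, GlueLeft] using hL
    have ht' : t (i + 1) = h (i + 1) := by
      rcases hO with ⟨hO1, -⟩ | ⟨-, -, hO2⟩
      · exact hO1
      · rcases hS with hS | hS <;> simp [hS] at hO2
    rw [ht'] at hd
    have hle := Nat.le_of_dvd (by omega) hd
    -- If `d (i + 1) = h (i + 1)`, the path is one row, and `GlueExtra` makes both sides agree on
    -- its direction.
    rcases hle.eq_or_lt with heq | hlt
    · rcases (hX hS).2 ⟨hE, heq⟩ with h5 | ⟨h5, h6⟩
      · exact Or.inr h5
      · exact Or.inl ⟨hd, by omega, by omega⟩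
    · exact Or.inl ⟨hd, hL'.1 fun hc => by have := hL'.2 hc; omega,
        (hX hS).1 (Or.inr ⟨hE, hlt⟩)⟩

/-! ### The tree -/

section Tree

variable {n : ℕ} {h r p q : ℕ → ℕ}

/-- The neighbour of a vertex on the path to the first vertex of the first horizontal path. -/
def parent (r p q : ℕ → ℕ) : GridName → GridName
  | Sum.inl (i, j) =>
    if i = 1 ∨ q (i - 1) < j then Sum.inl (i, j - 1)
    else if j < q (i - 1) then Sum.inl (i, j + 1)
    else verticalVertex r p q (i - 1) (r (i - 1) - 1)
  | Sum.inr (i, j) => verticalVertex r p q i (j - 1)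

/-- Root the ladder at the first vertex of the first path. Every later horizontal path hangs from
its vertex `q (i - 1)`, so a horizontal edge there belongs to its end farther from that vertex, and
a vertical edge to its lower end. -/
theorem exists_parent {e : Sym2 GridName} (he : e ∈ ladderEdges n h r p q) :
    ∃ c, c ≠ Sum.inl (1, 1) ∧ e = s(c, parent r p q c) := by
  rcases he with ⟨i, j, hi, -, hj, -, rfl⟩ | ⟨i, j, hi, -, hj, rfl⟩
  · by_cases hc : i = 1 ∨ q (i - 1) < j + 1
    · exact ⟨Sum.inl (i, j + 1), by simp; omega, by rw [parent, if_pos hc, Sym2.eq_swap]; rfl⟩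
    · refine ⟨Sum.inl (i, j), by simp; omega, ?_⟩
      rw [parent, if_neg (by omega), if_pos (by omega)]
  · by_cases hr : j + 1 = r i
    · refine ⟨Sum.inl (i + 1, q i), by simp; omega, ?_⟩
      rw [parent, if_neg (by simp; omega), if_neg (by simp), Nat.add_sub_cancel, ← hr,
        Nat.add_sub_cancel, hr, verticalVertex_last (by omega), Sym2.eq_swap]
      rfl
    · refine ⟨Sum.inr (i, j + 1), by simp, ?_⟩
      rw [parent, Nat.add_sub_cancel,
        verticalVertex_inner (j := j + 1) (by omega) (by omega), Sym2.eq_swap]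

theorem ne_of_mem_ladderEdges {x y : GridName} (he : s(x, y) ∈ ladderEdges n h r p q) : x ≠ y := by
  have key : ∀ u v, s(x, y) = s(u, v) → u ≠ v → x ≠ y := by
    rintro u v huv hne rfl
    rcases Sym2.eq_iff.1 huv with ⟨rfl, rfl⟩ | ⟨rfl, rfl⟩ <;> exact hne rfl
  rcases he with ⟨i, j, -, -, -, -, he⟩ | ⟨i, j, -, -, hj, he⟩
  · exact key _ _ he (by simp)
  · refine key _ _ he fun hv => ?_
    unfold verticalVertex at hv
    split_ifs at hv <;> simp at hv <;> omega

theorem stage_eq_ladderVerts (hn : 1 ≤ n) : stage h r n (h n) 0 = ladderVerts n h r := by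
  ext (⟨i, j⟩ | ⟨i, j⟩)
  · rw [inl_mem_stage]
    constructor
    · rintro ⟨h1, h2, h3 | ⟨rfl, h3⟩⟩
      · exact Or.inl ⟨i, j, h1, by omega, h2, h3.2, rfl⟩
      · exact Or.inl ⟨i, j, h1, le_rfl, h2, h3, rfl⟩
    · rintro (⟨i', j', h1, h2, h3, h4, he⟩ | ⟨i', j', h1, h2, h3, h4, he⟩)
      · cases he
        rcases h2.eq_or_lt with rfl | h5
        · exact ⟨h1, h3, Or.inr ⟨rfl, h4⟩⟩
        · exact ⟨h1, h3, Or.inl ⟨h5, h4⟩⟩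
      · cases he
  · rw [inr_mem_stage]
    constructor
    · rintro ⟨h1, h2, h3 | h3⟩
      · exact Or.inr ⟨i, j, h1, h3.1, h2, h3.2, rfl⟩
      · omega
    · rintro (⟨i', j', h1, h2, h3, h4, he⟩ | ⟨i', j', h1, h2, h3, h4, he⟩)
      · cases he
      · cases he
        exact ⟨h1, h3, Or.inl ⟨h2, h4⟩⟩

/-- The horizontal paths `i` with `F i` are reversed. -/
noncomputable def reverseIf (h : ℕ → ℕ) (F : ℕ → Prop) : GridName → GridName
  | Sum.inl (i, j) => open Classical in Sum.inl (i, if F i then h i + 1 - j else j)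
  | Sum.inr z => Sum.inr z

theorem reverseIf_mem {F : ℕ → Prop} {z : GridName} (hz : z ∈ ladderVerts n h r) :
    reverseIf h F z ∈ ladderVerts n h r := by
  rcases hz with ⟨i, j, h1, h2, h3, h4, rfl⟩ | ⟨i, j, h1, h2, h3, h4, rfl⟩
  · refine Or.inl ⟨i, _, h1, h2, ?_, ?_, rfl⟩ <;> split_ifs <;> omega
  · exact Or.inr ⟨i, j, h1, h2, h3, h4, rfl⟩

theorem reverseIf_reverseIf {F : ℕ → Prop} {z : GridName} (hz : z ∈ ladderVerts n h r) :
    reverseIf h F (reverseIf h F z) = z := by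
  rcases hz with ⟨i, j, h1, h2, h3, h4, rfl⟩ | ⟨i, j, h1, h2, h3, h4, rfl⟩
  · simp only [reverseIf, Sum.inl.injEq, Prod.mk.injEq, true_and]
    split_ifs <;> omega
  · rfl

theorem isPathLike_ladderTree (hn : 1 ≤ n) {F : ℕ → Prop} {R : List GridName}
    (hR : Built (fun x y => s(reverseIf h F x, reverseIf h F y) ∈ ladderEdges n h r p q)
      (stage h r n (h n) 0) R)
    (hroot : Sum.inl (1, 1) ∈ ladderVerts n h r) :
    IsPathLike (ladderTree n h r p q) := by
  classical
  rw [stage_eq_ladderVerts hn] at hR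
  let ψ : ladderVerts n h r ≃ ladderVerts n h r :=
    { toFun := fun x => ⟨reverseIf h F x, reverseIf_mem x.2⟩
      invFun := fun x => ⟨reverseIf h F x, reverseIf_mem x.2⟩
      left_inv := fun x => Subtype.ext (reverseIf_reverseIf x.2)
      right_inv := fun x => Subtype.ext (reverseIf_reverseIf x.2) }
  refine hR.isPathLike ψ (fun x y hxy => ?_) ⟨_, hroot⟩
    -- The default value is harmless: the parent end of an actual edge is always a vertex of the
    -- ladder.
    (fun x => if hx : parent r p q x ∈ ladderVerts n h r then ⟨_, hx⟩ else x) fun x y hxy => ?_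
  · simp only [ladderTree, SimpleGraph.comap_adj, SimpleGraph.induce, SimpleGraph.fromEdgeSet_adj]
    exact ⟨hxy, ne_of_mem_ladderEdges hxy⟩
  · simp only [ladderTree, SimpleGraph.comap_adj, SimpleGraph.induce,
      SimpleGraph.fromEdgeSet_adj] at hxy
    obtain ⟨c, hc, he⟩ := exists_parent hxy.1
    rcases Sym2.eq_iff.1 he with ⟨h1, h2⟩ | ⟨h1, h2⟩
    · left
      simp only [Function.Embedding.subtype_apply] at h1 h2
      subst h1
      refine ⟨fun h3 => hc (by rw [h3]), ?_⟩
      simp only [← h2, y.2, dif_pos]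
    · right
      simp only [Function.Embedding.subtype_apply] at h1 h2
      subst h2
      refine ⟨fun h3 => hc (by rw [h3]), ?_⟩
      simp only [← h1, x.2, dif_pos]

end Tree

/-- Reversal exchanges the positions `j` and `h i + 1 - j`. It is applied only to the outermost
paths; each carries one branch vertex and they are distinct since `2 ≤ n`, so no other position is
disturbed. -/
theorem isLadder_reverseIf {n : ℕ} {h r a b : ℕ → ℕ} (hP : IsHnParam n h r a b) {x y : ℕ}
    (hx : x = a 1 ∨ x = h 1 - a 1 + 1) (hy : y = b (n - 1) ∨ y = h n - b (n - 1) + 1) :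
    IsLadder (fun u v => s(reverseIf h (fun i => i = 1 ∧ x ≠ a 1 ∨ i = n ∧ y ≠ b (n - 1)) u,
        reverseIf h (fun i => i = 1 ∧ x ≠ a 1 ∨ i = n ∧ y ≠ b (n - 1)) v) ∈
        ladderEdges n h r (fun i => h i - a i + 1) b)
      n h r (Function.update a 1 x) (Function.update b (n - 1) y) := by
  obtain ⟨hn, hr, hab, hdisj⟩ := hP
  obtain ⟨a1, a2, -, -⟩ := hab 1 le_rfl (by omega)
  obtain ⟨-, -, b1, b2⟩ := hab (n - 1) (by omega) (by omega)
  rw [Nat.sub_add_cancel (by omega)] at b2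
  refine ⟨?_, ⟨hn, hr, ?_, ?_⟩, ?_, ?_⟩
  · intro u v huv
    rwa [Sym2.eq_swap]
  · intro i hi hin
    obtain ⟨h1, h2, h3, h4⟩ := hab i hi hin
    have ha : 1 < Function.update a 1 x i ∧ Function.update a 1 x i < h i := by
      by_cases h5 : i = 1
      · subst h5; rw [Function.update_self]; omega
      · rw [Function.update_of_ne h5]; omega
    have hb : 1 < Function.update b (n - 1) y i ∧ Function.update b (n - 1) y i < h (i + 1) := by
      by_cases h5 : i = n - 1
      · subst h5; rw [Function.update_self, Nat.sub_add_cancel (by omega)]; omega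
      · rw [Function.update_of_ne h5]; omega
    exact ⟨ha.1, ha.2, hb.1, hb.2⟩
  · intro i hi hin
    rw [Function.update_of_ne (by omega), Function.update_of_ne (by omega)]
    exact hdisj i hi hin
  · intro i j hi hin hj hjh
    simp only [hv, reverseIf]
    split_ifs
    · exact Or.inl ⟨i, h i - j, hi, hin, by omega, by omega, by
        rw [Sym2.eq_swap, show h i + 1 - (j + 1) = h i - j by omega,
          show h i + 1 - j = h i - j + 1 by omega]⟩
    · exact Or.inl ⟨i, j, hi, hin, hj, hjh, rfl⟩
  · intro i j hi hin hj
    have key : ∀ j, reverseIf h (fun i => i = 1 ∧ x ≠ a 1 ∨ i = n ∧ y ≠ b (n - 1))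
        (vv h r (Function.update a 1 x) (Function.update b (n - 1) y) i j) =
        verticalVertex r (fun i => h i - a i + 1) b i j := by
      intro j
      simp only [vv, verticalVertex]
      by_cases h0 : j = 0
      · simp only [h0, if_true, reverseIf, Sum.inl.injEq, Prod.mk.injEq, true_and]
        by_cases h5 : i = 1
        · subst h5
          rw [Function.update_self]
          split_ifs <;> omega
        · rw [Function.update_of_ne h5, if_neg (by omega)]
      · by_cases h1 : j = r i
        · simp only [h1, if_true]
          rw [if_neg (by omega), if_neg (by omega)]
          simp only [reverseIf, Sum.inl.injEq, Prod.mk.injEq, true_and]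
          by_cases h5 : i = n - 1
          · subst h5
            rw [Function.update_self, Nat.sub_add_cancel (by omega)]
            split_ifs <;> omega
          · rw [Function.update_of_ne h5, if_neg (by omega)]
        · simp only [h0, if_false, h1, reverseIf]
    rw [key, key]
    exact Or.inr ⟨i, j, hi, hin, hj, rfl⟩

theorem isPathLike_of_iso {V W : Type*} {T : SimpleGraph V} {T' : SimpleGraph W} (e : T ≃g T')
    (hT : IsPathLike T') : IsPathLike T := by
  obtain ⟨N, f, G, h1, h2, ⟨e'⟩⟩ := hT
  exact ⟨N, f, G, h1, h2, ⟨e.trans e'⟩⟩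

end LadderConfig

open LadderConfig in
/-- The tree `T_i` of type `H` has parameters `(s_i, t_{i+1}; r_i; a_i, b_i)`, with `s_1 = h_1` and
`t_n = h_n`. On the two outermost horizontal paths, which carry a single branch vertex, the position
of this vertex may be counted from either end (`a'`, `b'`). -/
theorem mainTheorem1 {V : Type*} (T : SimpleGraph V) (n : ℕ) (h r a b : ℕ → ℕ)
    (hT : IsTreeInHn T n h r a b)
    (hadj : NoAdjacentDegreeThree n h r a b)
    (α : ℕ → VerticalPath) (s t d δ : ℕ → ℕ)
    (hs1 : s 1 = h 1) (htn : t n = h n)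
    (hTi : ∀ i, 1 ≤ i → i ≤ n - 1 → ∃ a' b',
      (a' = a i ∨ (i = 1 ∧ a' = h 1 - a 1 + 1)) ∧
      (b' = b i ∨ (i = n - 1 ∧ b' = h n - b (n - 1) + 1)) ∧
      IsPathLikeTypeH (s i) (t (i + 1)) (r i) a' b' (α i) (d i) (d (i + 1)) (δ i))
    (hst : ∀ i, 2 ≤ i → i ≤ n - 1 → OrderRule (h i) (a i) (s i) (t i) (d i) (α i))
    (hleft : ∀ i, 2 ≤ i → i ≤ n - 1 → GlueLeft h r a b d δ i (α (i - 1)))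
    (hright : ∀ i, 2 ≤ i → i ≤ n - 1 → GlueRight n h r a b d δ i (α i))
    (hextra : ∀ i, 2 ≤ i → i ≤ n - 1 → GlueExtra h a b d δ α i) :
    IsPathLike T := by
  obtain ⟨hP, ⟨e⟩⟩ := hT
  obtain ⟨x, y, hx, hy, D⟩ := exists_divisors hP hs1 htn hTi hst hleft hright hextra
  obtain ⟨R, hR⟩ := (isLadder_reverseIf hP hx hy).exists_built D
  have hn := hP.1
  have ha := hP.2.2.1 1 le_rfl (by omega)
  exact isPathLike_of_iso e (isPathLike_ladderTree (by omega) hR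
    (Or.inl ⟨1, 1, le_rfl, by omega, le_rfl, by omega, rfl⟩))
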